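/- A funnel $F$ is a simple polygon, taken together with its interior, whose boundary consists of a base edge $l_1r_1$ and of two polygonal chains $\mathcal L=(l_1,\dots,l_k)$ and $\mathcal R=(r_1,\dots,r_j)$ ($k,j\ge 2$) that meet only in their common last vertex, the apex $l_k=r_j$, such that all vertices of $F$ other than $l_1$, $r_1$ and the apex are reflex (interior angle larger than $\pi$), those three are convex, and the vertices of each chain are numbered from bottom to top (by increasing distance from the line of the base, on one side of it). Two points of $F$ see each other if the segment between them is contained in $F$. A set $S$ of vertices of $F$ guards $F$ if every point of $F$ is seen by some vertex of $S$. A vertex-to-point conflict-free chromatic guarding of $F$ is a set $G$ of vertices of $F$ (the guards) with an assignment of colors to the guards such that every point $p$ of $F$ sees some guard whose color differs from the colors of all other guards seen by $p$; its number of colors is the number of different colors assigned to guards. (1) Let $m$ be the minimum size of a set of vertices that guards $F$. Then every vertex-to-point conflict-free chromatic guarding of $F$ uses at least $\lfloor\log_2(m+3)\rfloor-3$ colors. (2) There is an algorithm which, given the vertices of an arbitrary funnel $F$ with $n$ vertices, outputs after a number of steps that is at most polynomial in $n$ a vertex-to-point conflict-free chromatic guarding of $F$ whose number of colors is at most four larger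 than the minimum number of colors of a vertex-to-point conflict-free chromatic guarding of $F$. Here a step is one elementary operation of a random access machine that adds, subtracts and compares natural numbers, reads and writes arrays of natural numbers, and evaluates and compares integer polynomial expressions of bounded size in the (real) coordinates of the vertices. -/

import Mathlib

/-! ### Polygons, visibility, funnels -/

/-- Twice the signed area of the triangle `a b c`; positive iff `a, b, c` is a left turn. -/
def orient (a b c : ℝ × ℝ) : ℝ :=
  (b.1 - a.1) * (c.2 - a.2) - (b.2 - a.2) * (c.1 - a.1)

/-- The polygonal chain `v s, v (s+1), …, v e` as a set of points. -/
def polyChain (v : ℕ → ℝ × ℝ) (s e : ℕ) : Set (ℝ × ℝ) :=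
  {p | ∃ i, s ≤ i ∧ i < e ∧ p ∈ segment ℝ (v i) (v (i + 1))}

/-- The boundary of the closed polygon `v 0, …, v (n-1)`: all its edges, including the edge
from `v (n-1)` to `v 0`. -/
def polyBoundary (n : ℕ) (v : ℕ → ℝ × ℝ) : Set (ℝ × ℝ) :=
  polyChain v 0 (n - 1) ∪ segment ℝ (v (n - 1)) (v 0)

/-- The closed region enclosed by the polygon: its boundary together with the bounded connected
components of the complement of the boundary. -/
def polyRegion (n : ℕ) (v : ℕ → ℝ × ℝ) : Set (ℝ × ℝ) :=
  {p | p ∈ polyBoundary n v ∨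
    Bornology.IsBounded (connectedComponentIn (polyBoundary n v)ᶜ p)}

/-- A funnel, given by its `n` vertices `v 0, …, v (n-1)` listed clockwise so that the base is the
edge between `v 0` (the lower left vertex) and `v (n-1)` (the lower right vertex).  The left chain
is `v 0, …, v apex`, the right chain, read from its bottom, is `v (n-1), …, v apex`.
Values `v i` with `n ≤ i` play no role.  "Height" is measured from the base line, on the side of
the apex: the height of `p` is proportional to `orient (v 0) (v (n-1)) p`. -/
structure Funnel where
  n : ℕ
  apex : ℕ
  v : ℕ → ℝ × ℝ
  apex_pos : 0 < apex
  apex_lt : apex + 1 < n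
  /-- the vertices of the left chain are listed from bottom to top -/
  left_up : ∀ i, i < apex →
    orient (v 0) (v (n - 1)) (v i) < orient (v 0) (v (n - 1)) (v (i + 1))
  /-- the vertices of the right chain are listed from top to bottom -/
  right_down : ∀ i, apex ≤ i → i + 1 < n →
    orient (v 0) (v (n - 1)) (v (i + 1)) < orient (v 0) (v (n - 1)) (v i)
  /-- all vertices except `v 0`, `v apex`, `v (n-1)` are reflex (both chains are concave) -/
  reflex : ∀ i, i + 2 < n → i + 1 ≠ apex → 0 < orient (v i) (v (i + 1)) (v (i + 2))
  /-- the polygon is simple: the two chains meet in the apex only -/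
  simple : polyChain v 0 apex ∩ polyChain v apex (n - 1) = {v apex}

namespace Funnel

/-- The points of the funnel (boundary included). -/
def region (F : Funnel) : Set (ℝ × ℝ) := polyRegion F.n F.v

/-- `p` and `q` see each other: the segment between them belongs to the funnel. -/
def Sees (F : Funnel) (p q : ℝ × ℝ) : Prop := segment ℝ p q ⊆ F.region

/-- Vertex-to-point guarding: every point of the funnel is seen by some vertex in `S`. -/
def IsGuarding (F : Funnel) (S : Finset (Fin F.n)) : Prop :=
  ∀ p ∈ F.region, ∃ g ∈ S, F.Sees p (F.v g)

/-- The minimum number of vertex guards that guard all points of the funnel. -/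
noncomputable def guardNumber (F : Funnel) : ℕ :=
  sInf {k | ∃ S : Finset (Fin F.n), F.IsGuarding S ∧ S.card = k}

/-- Vertex-to-point conflict-free chromatic guarding: guards on the vertices in `G`, the guard at
`g` having color `c g`, such that every point of the funnel sees a guard whose color differs from
the colors of all other guards that this point sees. -/
def IsConflictFree (F : Funnel) (G : Finset (Fin F.n)) (c : Fin F.n → ℕ) : Prop :=
  ∀ p ∈ F.region, ∃ g ∈ G, F.Sees p (F.v g) ∧
    ∀ g' ∈ G, F.Sees p (F.v g') → c g' = c g → g' = g

end Funnel

/-- The number of colors used by the guards in `G`. -/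
def numColors {n : ℕ} (G : Finset (Fin n)) (c : Fin n → ℕ) : ℕ := (G.image c).card

/-! ### Algorithms

A random access machine with finitely many named arrays of natural numbers as working memory, and
with read-only access to the (real) input coordinates.  A program may compare the values of integer
polynomial expressions in the coordinates.  Real intermediate results are not stored, so that this
is a restriction of the real RAM: expressions have a size bounded by the size of the program, and
natural numbers are only added and subtracted.  Every evaluated node of an expression and every
executed instruction costs one step. -/

namespace RAM

/-- Working memory: `σ a i` is the entry with index `i` of the array with name `a`. -/
abbrev Mem := ℕ → ℕ → ℕ

/-- Expressions for natural numbers; `get a i` reads an array, `sub` is truncated. -/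
inductive NExp
  | lit (c : ℕ)
  | get (a : ℕ) (i : NExp)
  | add (e f : NExp)
  | sub (e f : NExp)

/-- Expressions for reals; `x i` and `y i` read the coordinates of the input point `i`. -/
inductive RExp
  | lit (z : ℤ)
  | x (i : NExp)
  | y (i : NExp)
  | add (e f : RExp)
  | sub (e f : RExp)
  | mul (e f : RExp)

/-- Tests. -/
inductive BExp
  | nlt (e f : NExp)
  | rlt (e f : RExp)
  | not (b : BExp)
  | and (b b' : BExp)

/-- Programs; `set a i e` stores the value of `e` in the array `a` at index `i`. -/
inductive Prog
  | skip
  | set (a : ℕ) (i e : NExp)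
  | seq (P Q : Prog)
  | ite (b : BExp) (P Q : Prog)
  | while (b : BExp) (P : Prog)

def NExp.eval (σ : Mem) : NExp → ℕ
  | lit c => c
  | get a i => σ a (i.eval σ)
  | add e f => e.eval σ + f.eval σ
  | sub e f => e.eval σ - f.eval σ

def NExp.cost : NExp → ℕ
  | lit _ => 1
  | get _ i => i.cost + 1
  | add e f => e.cost + f.cost + 1
  | sub e f => e.cost + f.cost + 1

noncomputable def RExp.eval (pt : ℕ → ℝ × ℝ) (σ : Mem) : RExp → ℝ
  | lit z => z
  | x i => (pt (i.eval σ)).1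
  | y i => (pt (i.eval σ)).2
  | add e f => e.eval pt σ + f.eval pt σ
  | sub e f => e.eval pt σ - f.eval pt σ
  | mul e f => e.eval pt σ * f.eval pt σ

def RExp.cost : RExp → ℕ
  | lit _ => 1
  | x i => i.cost + 1
  | y i => i.cost + 1
  | add e f => e.cost + f.cost + 1
  | sub e f => e.cost + f.cost + 1
  | mul e f => e.cost + f.cost + 1

def BExp.Holds (pt : ℕ → ℝ × ℝ) (σ : Mem) : BExp → Prop
  | nlt e f => e.eval σ < f.eval σ
  | rlt e f => e.eval pt σ < f.eval pt σ
  | not b => ¬ b.Holds pt σ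
  | and b b' => b.Holds pt σ ∧ b'.Holds pt σ

def BExp.cost : BExp → ℕ
  | nlt e f => e.cost + f.cost + 1
  | rlt e f => e.cost + f.cost + 1
  | not b => b.cost + 1
  | and b b' => b.cost + b'.cost + 1

/-- `Mem.store σ a i k` is `σ` with the entry `i` of the array `a` replaced by `k`. -/
def Mem.store (σ : Mem) (a i k : ℕ) : Mem :=
  Function.update σ a (Function.update (σ a) i k)

/-- `Exec pt P σ τ t`: on input points `pt`, the program `P` started with memory `σ` halts with
memory `τ` after exactly `t` steps. -/
inductive Exec (pt : ℕ → ℝ × ℝ) : Prog → Mem → Mem → ℕ → Prop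
  | skip (σ : Mem) : Exec pt .skip σ σ 1
  | set (a : ℕ) (i e : NExp) (σ : Mem) :
      Exec pt (.set a i e) σ (σ.store a (i.eval σ) (e.eval σ)) (i.cost + e.cost + 1)
  | seq {P Q : Prog} {σ τ υ : Mem} {t u : ℕ} :
      Exec pt P σ τ t → Exec pt Q τ υ u → Exec pt (.seq P Q) σ υ (t + u)
  | iteTrue {b : BExp} {P Q : Prog} {σ τ : Mem} {t : ℕ} :
      b.Holds pt σ → Exec pt P σ τ t → Exec pt (.ite b P Q) σ τ (b.cost + t + 1)
  | iteFalse {b : BExp} {P Q : Prog} {σ τ : Mem} {t : ℕ} :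
      ¬ b.Holds pt σ → Exec pt Q σ τ t → Exec pt (.ite b P Q) σ τ (b.cost + t + 1)
  | whileFalse {b : BExp} {P : Prog} {σ : Mem} :
      ¬ b.Holds pt σ → Exec pt (.while b P) σ σ (b.cost + 1)
  | whileTrue {b : BExp} {P : Prog} {σ τ υ : Mem} {t u : ℕ} :
      b.Holds pt σ → Exec pt P σ τ t → Exec pt (.while b P) τ υ u →
        Exec pt (.while b P) σ υ (b.cost + t + u + 1)

end RAM

namespace Funnel

/-- The input points of an algorithm run on `F`: the vertices of `F`, and nothing else. -/
noncomputable def inputPoints (F : Funnel) : ℕ → ℝ × ℝ := fun i => if i < F.n then F.v i else 0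

/-- The initial memory of an algorithm run on `F`: array `0` holds the number of vertices and the
index of the apex; everything else is `0`. -/
def inputMem (F : Funnel) : RAM.Mem :=
  fun a i => if a = 0 then (if i = 0 then F.n else if i = 1 then F.apex else 0) else 0

/-- The output of an algorithm run on `F` is read from array `1`: entry `i < n` is the color of
the guard at vertex `i`, and it is `0` if there is no guard at vertex `i`. -/
def outputColor (F : Funnel) (τ : RAM.Mem) : Fin F.n → ℕ := fun i => τ 1 i

/-- The set of vertices at which the output places a guard. -/
def outputGuards (F : Funnel) (τ : RAM.Mem) : Finset (Fin F.n) :=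
  Finset.univ.filter fun i => F.outputColor τ i ≠ 0

end Funnel

/-! ### Concave chains -/

/-! Measured by height above the base line, each chain is the minimum of the lines of its edges, and
two points see each other when the segment between them stays on the right of both chains (`Clear`,
once for each side). Since the chains meet only in the apex, every edge line of one chain and every
edge line of the other approach each other upwards (`slope_add_slope_pos`); most visibility
arguments combine this with the concavity of the chains.

Both halves of the theorem rest on one greedy sequence of guards. It starts at the lower left
vertex. From a guard, extend the chain edge that leaves it upwards; the next guard is the highest
vertex of the opposite chain not beyond this extension (`hit`). The sequence stops at the apex, and
`count` is the number of guards before it.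

Upper bound: a point above the extension at a guard does not see that guard, and the first guard
whose extension it is not above does see it (`exists_first_guard`). From that guard on, a point that
sees guard `k` sees all earlier ones, except possibly guard `k - 1` (`sees_guard_of_sees`). The
modified ruler coloring has, between two equal colors, a larger one that is not directly before the
second (`exists_larger`). Hence the largest visible color is unique, and at most `log₂ count + 2`
colors are used. In particular the greedy guards guard the funnel, so `m ≤ count`.

Lower bound: group the vertices into zones delimited by every second greedy guard. For zones `a + 2
≤ b`, a suitable crossing of two edge lines sees only vertices of the zones from `a` to `b`, and all
of those beyond zone `a` (`exists_witness`). The guard with unique color at this point lies in one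
zone, and its color is missing in the zones on either side of it, apart from zone `a`. Induction on
the number `k` of colors gives `b + 3 ≤ a + 4 * 2 ^ k` (`zones_le`), hence `count + 4 ≤ 8 * 2 ^ k`
for every conflict-free guarding. This yields the bound in terms of `m`, and `log₂ count < k + 3`
gives the additive error four.

The greedy step only needs signs of orientations of vertices, so a linear search performs it exactly
on the machine. -/

/-- A polygonal chain with vertices `(x 0, y 0), …, (x k, y k)` of increasing heights `y` whose
edges have decreasing slopes `dx / dy`, starting at height zero. -/
structure ConcaveChain where
  k : ℕ
  x : ℕ → ℝ
  y : ℕ → ℝ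
  k_pos : 0 < k
  y_zero : y 0 = 0
  y_lt_succ : ∀ i, i < k → y i < y (i + 1)
  slope_lt : ∀ i, i + 1 < k →
    (x (i + 2) - x (i + 1)) / (y (i + 2) - y (i + 1)) < (x (i + 1) - x i) / (y (i + 1) - y i)

namespace ConcaveChain

variable (c : ConcaveChain)

/-- The slope of the edge number `i`. -/
noncomputable def slope (i : ℕ) : ℝ := (c.x (i + 1) - c.x i) / (c.y (i + 1) - c.y i)

/-- The abscissa at height `h` of the line through the edge number `i`. -/
noncomputable def line (i : ℕ) (h : ℝ) : ℝ := c.x i + c.slope i * (h - c.y i)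

/-- The abscissa at height `h` of the chain. -/
noncomputable def f (h : ℝ) : ℝ :=
  (Finset.range c.k).inf' ⟨0, Finset.mem_range.2 c.k_pos⟩ fun i => c.line i h

/-- The segment between `(X, h)` and `(X', h')` stays on the right of the chain. -/
def Clear (X h X' h' : ℝ) : Prop :=
  ∀ t : ℝ, 0 ≤ t → t ≤ 1 → c.f (h + t * (h' - h)) ≤ X + t * (X' - X)

variable {c}

lemma y_lt {i j : ℕ} (hij : i < j) (hj : j ≤ c.k) : c.y i < c.y j := by
  induction j, hij using Nat.le_induction with
  | base => exact c.y_lt_succ i (by omega)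
  | succ j hij ih => exact (ih (by omega)).trans (c.y_lt_succ j (by omega))

lemma y_le {i j : ℕ} (hij : i ≤ j) (hj : j ≤ c.k) : c.y i ≤ c.y j := by
  rcases hij.eq_or_lt with rfl | h
  · exact le_rfl
  · exact (y_lt h hj).le

lemma lt_of_y_lt {i j : ℕ} (hi : i ≤ c.k) (h : c.y i < c.y j) : i < j := by
  by_contra! hc
  exact absurd (y_le hc hi) (not_le.2 h)

lemma y_nonneg {i : ℕ} (hi : i ≤ c.k) : 0 ≤ c.y i := by
  rw [← c.y_zero]; exact y_le (Nat.zero_le i) hi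

lemma slope_lt_slope {i j : ℕ} (hij : i < j) (hj : j < c.k) : c.slope j < c.slope i := by
  induction j, hij using Nat.le_induction with
  | base => exact c.slope_lt i hj
  | succ j hij ih => exact (c.slope_lt j hj).trans (ih (by omega))

lemma slope_le_slope {i j : ℕ} (hij : i ≤ j) (hj : j < c.k) : c.slope j ≤ c.slope i := by
  rcases hij.eq_or_lt with rfl | h
  · exact le_rfl
  · exact (slope_lt_slope h hj).le

@[simp] lemma line_left (i : ℕ) : c.line i (c.y i) = c.x i := by simp [line]

lemma line_right {i : ℕ} (hi : i < c.k) : c.line i (c.y (i + 1)) = c.x (i + 1) := by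
  have := c.y_lt_succ i hi
  rw [line, slope, div_mul_cancel₀ _ (by linarith)]
  ring

lemma line_sub_line (i : ℕ) (h h' : ℝ) : c.line i h - c.line i h' = c.slope i * (h - h') := by
  simp only [line]; ring

lemma line_add (i : ℕ) (h h' t : ℝ) :
    c.line i (h + t * (h' - h)) = c.line i h + t * (c.line i h' - c.line i h) := by
  simp only [line]; ring

/-- Consecutive edge lines meet in their common vertex. The comparisons of arbitrary edge lines
below follow from this identity by induction along the chain. -/
lemma line_succ_sub {i : ℕ} (hi : i + 1 < c.k) (h : ℝ) :
    c.line (i + 1) h - c.line i h = (c.slope (i + 1) - c.slope i) * (h - c.y (i + 1)) := by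
  have h1 := line_sub_line (c := c) i h (c.y (i + 1))
  have h2 := line_sub_line (c := c) (i + 1) h (c.y (i + 1))
  rw [line_right (by omega)] at h1
  rw [line_left] at h2
  linarith

lemma line_le_of_le {i j : ℕ} (hij : i ≤ j) (hj : j < c.k) {h : ℝ} (hh : h ≤ c.y (i + 1)) :
    c.line i h ≤ c.line j h := by
  induction j, hij using Nat.le_induction with
  | base => exact le_rfl
  | succ j hij ih =>
    have h1 := line_succ_sub hj h
    have h2 := c.slope_lt j hj
    have h3 := ih (by omega)
    have h4 : c.y (i + 1) ≤ c.y (j + 1) := y_le (by omega) (by omega)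
    have : 0 ≤ (c.slope (j + 1) - c.slope j) * (h - c.y (j + 1)) :=
      mul_nonneg_of_nonpos_of_nonpos (sub_nonpos.2 h2.le) (by linarith)
    linarith

lemma line_le_of_ge {i j : ℕ} (hij : i ≤ j) (hj : j < c.k) {h : ℝ} (hh : c.y j ≤ h) :
    c.line j h ≤ c.line i h := by
  induction j, hij using Nat.le_induction with
  | base => exact le_rfl
  | succ j hij ih =>
    have h1 := line_succ_sub hj h
    have h2 := c.slope_lt j hj
    have h4 : c.y j ≤ c.y (j + 1) := y_le (by omega) (by omega)
    have h3 := ih (by omega) (by linarith)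
    have : (c.slope (j + 1) - c.slope j) * (h - c.y (j + 1)) ≤ 0 :=
      mul_nonpos_of_nonpos_of_nonneg (sub_nonpos.2 h2.le) (by linarith)
    linarith

lemma line_lt_of_lt {i j : ℕ} (hij : i < j) (hj : j < c.k) {h : ℝ} (hh : h < c.y (i + 1)) :
    c.line i h < c.line j h := by
  have h1 := line_sub_line (c := c) i h (c.y (i + 1))
  have h2 := line_sub_line (c := c) j h (c.y (i + 1))
  have h3 : c.line i (c.y (i + 1)) ≤ c.line j (c.y (i + 1)) := line_le_of_le hij.le hj le_rfl
  nlinarith [slope_lt_slope hij hj]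

lemma line_lt_of_gt {i j : ℕ} (hij : i < j) (hj : j < c.k) {h : ℝ} (hh : c.y j < h) :
    c.line j h < c.line i h := by
  have h1 := line_sub_line (c := c) i h (c.y j)
  have h2 := line_sub_line (c := c) j h (c.y j)
  have h3 : c.line j (c.y j) ≤ c.line i (c.y j) := line_le_of_ge hij.le hj le_rfl
  nlinarith [slope_lt_slope hij hj]

lemma f_le_line {i : ℕ} (hi : i < c.k) (h : ℝ) : c.f h ≤ c.line i h :=
  Finset.inf'_le _ (Finset.mem_range.2 hi)

/-- Concavity: over the height range of an edge, its line is the lowest of all edge lines. So the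
minimum defining `f` really is the chain. -/
lemma f_eq_line {i : ℕ} (hi : i < c.k) {h : ℝ} (h1 : c.y i ≤ h) (h2 : h ≤ c.y (i + 1)) :
    c.f h = c.line i h := by
  refine le_antisymm (f_le_line hi h) (Finset.le_inf' _ _ fun j hj => ?_)
  rcases le_total i j with hij | hij
  · exact line_le_of_le hij (Finset.mem_range.1 hj) h2
  · exact line_le_of_ge hij hi h1

lemma f_y {i : ℕ} (hi : i ≤ c.k) : c.f (c.y i) = c.x i := by
  rcases hi.lt_or_eq with hi | rfl
  · rw [f_eq_line hi le_rfl (c.y_lt_succ i hi).le, line_left]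
  · obtain ⟨m, hm⟩ : ∃ m, c.k = m + 1 := ⟨c.k - 1, by have := c.k_pos; omega⟩
    rw [hm, f_eq_line (i := m) (by omega) (y_le (by omega) (by omega)) le_rfl,
      line_right (by omega)]

lemma x_le_line {i j : ℕ} (hi : i < c.k) (hj : j ≤ c.k) : c.x j ≤ c.line i (c.y j) := by
  rw [← f_y hj]; exact f_le_line hi _

lemma exists_edge {h : ℝ} (h0 : 0 ≤ h) (h1 : h ≤ c.y c.k) :
    ∃ e, e < c.k ∧ c.y e ≤ h ∧ h ≤ c.y (e + 1) ∧ c.f h = c.line e h := by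
  classical
  have hk := c.k_pos
  -- The search is capped at `c.k - 1`, so that the result is an edge even at the top height.
  have hP : c.y (Nat.findGreatest (fun e => c.y e ≤ h) (c.k - 1)) ≤ h :=
    Nat.findGreatest_spec (P := fun e => c.y e ≤ h) (Nat.zero_le _) (by rw [c.y_zero]; exact h0)
  have hle := Nat.findGreatest_le (P := fun e => c.y e ≤ h) (c.k - 1)
  generalize hE : Nat.findGreatest (fun e => c.y e ≤ h) (c.k - 1) = e at *
  have h2 : h ≤ c.y (e + 1) := by
    rcases Nat.lt_or_ge (e + 1) c.k with hlt | hge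
    · by_contra! hc
      exact Nat.findGreatest_is_greatest (P := fun e => c.y e ≤ h) (n := c.k - 1) (k := e + 1)
        (by omega) (by omega) hc.le
    · have : e + 1 = c.k := by omega
      rw [this]; exact h1
  exact ⟨e, by omega, hP, h2, f_eq_line (by omega) hP h2⟩

lemma continuous_line (i : ℕ) : Continuous (c.line i) := by
  unfold line; fun_prop

lemma continuous_f : Continuous c.f :=
  Continuous.finset_inf'_apply _ fun i _ => continuous_line i

/-! ### Segments that stay on the right of one chain. -/

lemma Clear.symm {X h X' h' : ℝ} (H : c.Clear X h X' h') : c.Clear X' h' X h := by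
  intro t h0 h1
  have := H (1 - t) (by linarith) (by linarith)
  convert this using 1
  · congr 1; ring
  · ring

/-- A line of an edge with both end points of a segment on its right. -/
lemma clear_of_line {i : ℕ} (hi : i < c.k) {X h X' h' : ℝ} (h1 : c.line i h ≤ X)
    (h2 : c.line i h' ≤ X') : c.Clear X h X' h' := by
  intro t t0 t1
  refine (f_le_line hi _).trans ?_
  rw [line_add]
  nlinarith

/-- At a height between its ends, a clear segment lies on the right of the chain. -/
lemma Clear.at_height {X h X' h' : ℝ} (H : c.Clear X h X' h') {η : ℝ} (h1 : h ≤ η) (h2 : η ≤ h')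
    (hlt : h < h') : c.f η * (h' - h) ≤ X * (h' - η) + X' * (η - h) := by
  have hpos : 0 < h' - h := by linarith
  have := H ((η - h) / (h' - h)) (by apply div_nonneg <;> linarith)
    (by rw [div_le_one hpos]; linarith)
  rw [div_mul_cancel₀ _ hpos.ne'] at this
  rw [show h + (η - h) = η by ring] at this
  have h3 := mul_le_mul_of_nonneg_right this hpos.le
  have h4 : (X + (η - h) / (h' - h) * (X' - X)) * (h' - h) = X * (h' - η) + X' * (η - h) := by
    field_simp; ring
  linarith

/-- A segment on the right of a clear segment with the same lower end is clear. -/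
lemma Clear.mono {X h X' h' : ℝ} (H : c.Clear X h X' h') {X₁ η : ℝ} (h1 : h ≤ η) (h2 : η ≤ h')
    (hlt : h < h') (hX : X * (h' - η) + X' * (η - h) ≤ X₁ * (h' - h)) : c.Clear X h X₁ η := by
  intro t t0 t1
  have hpos : 0 < h' - h := by linarith
  have key := H.at_height (η := h + t * (η - h)) (by nlinarith) (by nlinarith) hlt
  refine le_of_mul_le_mul_right (key.trans ?_) hpos
  nlinarith

/-- Just above the vertex the chain is its upper edge, so only the direction in which the segment
leaves the vertex matters; the concave chain stays left of the line of that edge afterwards. -/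
lemma clear_up_iff {i : ℕ} (hi : i < c.k) {X h : ℝ} (hh : c.y i < h) :
    c.Clear (c.x i) (c.y i) X h ↔ c.line i h ≤ X := by
  refine ⟨fun H => ?_, fun H => clear_of_line hi (line_left i).le H⟩
  have hy := c.y_lt_succ i hi
  -- At this height the chain is still the edge `i`; the comparison made there is then scaled up to
  -- the height `h`.
  have h1 : c.y i ≤ min h (c.y (i + 1)) := le_min hh.le hy.le
  have hm : c.y i < min h (c.y (i + 1)) := lt_min hh hy
  have := H.at_height (η := min h (c.y (i + 1))) h1 (min_le_left _ _) hh
  rw [f_eq_line hi h1 (min_le_right _ _)] at this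
  have e1 := line_sub_line (c := c) i (min h (c.y (i + 1))) (c.y i)
  have e2 := line_sub_line (c := c) i h (c.y i)
  rw [line_left] at e1 e2
  generalize min h (c.y (i + 1)) = m at *
  have e3 : c.line i m * (h - c.y i) = c.x i * (h - m) + c.line i h * (m - c.y i) := by
    rw [show c.line i m = c.x i + c.slope i * (m - c.y i) by linarith,
      show c.line i h = c.x i + c.slope i * (h - c.y i) by linarith]
    ring
  rw [e3] at this
  exact le_of_mul_le_mul_right (by linarith) (sub_pos.2 hm)

lemma clear_down_iff {i : ℕ} (hi : i < c.k) {X h : ℝ} (hh : h < c.y (i + 1)) :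
    c.Clear X h (c.x (i + 1)) (c.y (i + 1)) ↔ c.line i h ≤ X := by
  refine ⟨fun H => ?_, fun H => clear_of_line hi H (line_right hi).le⟩
  have hy := c.y_lt_succ i hi
  have h1 : max h (c.y i) ≤ c.y (i + 1) := max_le hh.le hy.le
  have hm : max h (c.y i) < c.y (i + 1) := max_lt hh hy
  have := H.at_height (η := max h (c.y i)) (le_max_left _ _) h1 hh
  rw [f_eq_line hi (le_max_right _ _) h1] at this
  have e1 := line_sub_line (c := c) i (max h (c.y i)) (c.y (i + 1))
  have e2 := line_sub_line (c := c) i h (c.y (i + 1))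
  rw [line_right hi] at e1 e2
  generalize max h (c.y i) = m at *
  have e3 : c.line i m * (c.y (i + 1) - h) =
      c.line i h * (c.y (i + 1) - m) + c.x (i + 1) * (m - h) := by
    rw [show c.line i m = c.x (i + 1) + c.slope i * (m - c.y (i + 1)) by linarith,
      show c.line i h = c.x (i + 1) + c.slope i * (h - c.y (i + 1)) by linarith]
    ring
  rw [e3] at this
  exact le_of_mul_le_mul_right (by linarith) (sub_pos.2 hm)

end ConcaveChain

/-! ### Two concave chains that meet in their last vertices -/

/-- A funnel in normal form: the left chain, and the mirror image of the right chain. The two sides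
are indexed by `Bool`, so that the symmetry between them is `!`. -/
structure TwoChains where
  c : Bool → ConcaveChain
  top : ℝ
  y_top : ∀ s, (c s).y (c s).k = top
  x_top : ∀ s, (c s).x (c s).k + (c !s).x (c !s).k = 0
  apart : ∀ s h, 0 ≤ h → h < top → (c s).f h + (c !s).f h < 0

/-- The abscissa of a point as measured from the side `s`. -/
def coord (s : Bool) (p : ℝ × ℝ) : ℝ := if s then p.1 else -p.1

lemma coord_not (s : Bool) (p : ℝ × ℝ) : coord (!s) p = -coord s p := by
  cases s <;> simp [coord]

namespace TwoChains

open ConcaveChain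

variable (T : TwoChains)

/-- The points between the two chains. -/
def Mem (p : ℝ × ℝ) : Prop := 0 ≤ p.2 ∧ p.2 ≤ T.top ∧ ∀ s, (T.c s).f p.2 ≤ coord s p

/-- Visibility: the segment crosses neither of the chains. -/
def Sees (p q : ℝ × ℝ) : Prop := ∀ s, (T.c s).Clear (coord s p) p.2 (coord s q) q.2

/-- The vertex number `i` of the chain `s`. -/
def vertex (s : Bool) (i : ℕ) : ℝ × ℝ :=
  (if s then (T.c s).x i else -(T.c s).x i, (T.c s).y i)

variable {T}

@[simp] lemma vertex_snd (s : Bool) (i : ℕ) : (T.vertex s i).2 = (T.c s).y i := rfl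

@[simp] lemma coord_vertex (s : Bool) (i : ℕ) : coord s (T.vertex s i) = (T.c s).x i := by
  cases s <;> simp [coord, vertex]

lemma coord_not_vertex (s : Bool) (i : ℕ) : coord (!s) (T.vertex s i) = -(T.c s).x i := by
  rw [coord_not, coord_vertex]

lemma coord_vertex_not (s : Bool) (i : ℕ) : coord s (T.vertex (!s) i) = -(T.c !s).x i := by
  have := coord_not_vertex (T := T) (!s) i
  rwa [Bool.not_not] at this

lemma Sees.symm {p q : ℝ × ℝ} (h : T.Sees p q) : T.Sees q p := fun s => (h s).symm

lemma sees_of_sides {p q : ℝ × ℝ} (s : Bool) (h1 : (T.c s).Clear (coord s p) p.2 (coord s q) q.2)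
    (h2 : (T.c !s).Clear (coord (!s) p) p.2 (coord (!s) q) q.2) : T.Sees p q := by
  intro s'
  rcases Bool.eq_or_eq_not s' s with rfl | rfl
  · exact h1
  · exact h2

lemma y_le_top {s : Bool} {i : ℕ} (hi : i ≤ (T.c s).k) : (T.c s).y i ≤ T.top := by
  rw [← T.y_top s]; exact y_le hi le_rfl

lemma y_lt_top {s : Bool} {i : ℕ} (hi : i < (T.c s).k) : (T.c s).y i < T.top := by
  rw [← T.y_top s]; exact y_lt hi le_rfl

lemma f_add_f_nonpos (s : Bool) {h : ℝ} (h0 : 0 ≤ h) (h1 : h ≤ T.top) :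
    (T.c s).f h + (T.c !s).f h ≤ 0 := by
  rcases h1.lt_or_eq with h1 | rfl
  · exact (T.apart s h h0 h1).le
  · have e1 := f_y (c := T.c s) le_rfl
    have e2 := f_y (c := T.c !s) le_rfl
    rw [T.y_top] at e1 e2
    rw [e1, e2, T.x_top]

/-- The last edges of the two chains are apart below the apex and meet in it, so they converge; all
lower edges have slopes at least as large. -/
lemma slope_add_slope_pos (s : Bool) {i j : ℕ} (hi : i < (T.c s).k) (hj : j < (T.c !s).k) :
    0 < (T.c s).slope i + (T.c !s).slope j := by
  obtain ⟨a, ha⟩ : ∃ a, (T.c s).k = a + 1 := ⟨_, (Nat.succ_pred_eq_of_pos (T.c s).k_pos).symm⟩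
  obtain ⟨b, hb⟩ : ∃ b, (T.c !s).k = b + 1 := ⟨_, (Nat.succ_pred_eq_of_pos (T.c !s).k_pos).symm⟩
  have h1 : (T.c s).slope a ≤ (T.c s).slope i := slope_le_slope (by omega) (by omega)
  have h2 : (T.c !s).slope b ≤ (T.c !s).slope j := slope_le_slope (by omega) (by omega)
  have ta : (T.c s).y (a + 1) = T.top := by rw [← ha]; exact T.y_top s
  have tb : (T.c !s).y (b + 1) = T.top := by rw [← hb]; exact T.y_top !s
  have la : (T.c s).y a < T.top := y_lt_top (by omega)
  have lb : (T.c !s).y b < T.top := y_lt_top (by omega)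
  have hm : max ((T.c s).y a) ((T.c !s).y b) < T.top := max_lt la lb
  have key := T.apart s (max ((T.c s).y a) ((T.c !s).y b))
    (le_max_of_le_left (y_nonneg (by omega))) hm
  rw [f_eq_line (i := a) (by omega) (le_max_left _ _) (by rw [ta]; exact hm.le),
    f_eq_line (c := T.c !s) (i := b) (by omega) (le_max_right _ _) (by rw [tb]; exact hm.le)] at key
  generalize max ((T.c s).y a) ((T.c !s).y b) = m at *
  have e1 := line_sub_line (c := T.c s) a m ((T.c s).y (a + 1))
  have e2 := line_sub_line (c := T.c !s) b m ((T.c !s).y (b + 1))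
  rw [line_right (by omega), ta, ← ha] at e1
  rw [line_right (by omega), tb, ← hb] at e2
  have e3 := T.x_top s
  by_contra! hc
  have : 0 ≤ ((T.c s).slope a + (T.c !s).slope b) * (m - T.top) :=
    mul_nonneg_of_nonpos_of_nonpos (by linarith) (by linarith)
  linarith

lemma line_add_line_sub_pos (s : Bool) {i j : ℕ} (hi : i < (T.c s).k) (hj : j < (T.c !s).k)
    {h h' : ℝ} (hh : h < h') :
    (T.c s).line i h + (T.c !s).line j h < (T.c s).line i h' + (T.c !s).line j h' := by
  have e1 := line_sub_line (c := T.c s) i h' h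
  have e2 := line_sub_line (c := T.c !s) j h' h
  have := mul_pos (slope_add_slope_pos s hi hj) (sub_pos.2 hh)
  linarith

lemma line_add_line_mono (s : Bool) {i j : ℕ} (hi : i < (T.c s).k) (hj : j < (T.c !s).k)
    {h h' : ℝ} (hh : h ≤ h') :
    (T.c s).line i h + (T.c !s).line j h ≤ (T.c s).line i h' + (T.c !s).line j h' := by
  rcases hh.eq_or_lt with rfl | hh
  · exact le_rfl
  · exact (line_add_line_sub_pos s hi hj hh).le

/-- A vertex sees every point above it that is below the extension of its upper edge. -/
lemma sees_up {s : Bool} {i : ℕ} (hi : i < (T.c s).k) {q : ℝ × ℝ} (hq : T.Mem q)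
    (hh : (T.c s).y i ≤ q.2) (hl : (T.c s).line i q.2 ≤ coord s q) : T.Sees (T.vertex s i) q := by
  obtain ⟨e, he, -, -, hf⟩ := exists_edge (c := T.c !s) hq.1 (by rw [T.y_top]; exact hq.2.1)
  have h1 := hq.2.2 !s
  rw [hf] at h1
  -- For the opposite chain, use its edge at the height of `q`: downwards its line and the line of
  -- the edge `i` diverge, so the vertex stays on the correct side.
  refine sees_of_sides s (clear_of_line hi (by simp) hl) (clear_of_line he ?_ h1)
  rw [coord_not] at h1
  rw [coord_not_vertex, vertex_snd]
  have := line_add_line_mono s hi he hh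
  rw [line_left] at this
  linarith

lemma not_sees_up {s : Bool} {i : ℕ} (hi : i < (T.c s).k) {q : ℝ × ℝ}
    (hh : (T.c s).y i < q.2) (hl : coord s q < (T.c s).line i q.2) : ¬ T.Sees (T.vertex s i) q := by
  intro H
  have := H s
  rw [coord_vertex, vertex_snd, clear_up_iff hi hh] at this
  linarith

lemma Sees.line_le_of_lt {s : Bool} {i : ℕ} (hi : i < (T.c s).k) {q : ℝ × ℝ}
    (hh : q.2 < (T.c s).y (i + 1)) (H : T.Sees q (T.vertex s (i + 1))) :
    (T.c s).line i q.2 ≤ coord s q := by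
  have := H s
  rwa [coord_vertex, vertex_snd, clear_down_iff hi hh] at this

/-! ### The reach of the extension of an edge on the opposite chain. -/

variable (T) in
/-- The vertex `j` of the chain `!s` is not above the line of the edge `i` of the chain `s`. -/
def Under (s : Bool) (i j : ℕ) : Prop := (T.c !s).x j + (T.c s).line i ((T.c !s).y j) ≤ 0

lemma under_of_succ {s : Bool} {i j : ℕ} (hi : i < (T.c s).k) (hj : j < (T.c !s).k)
    (h : T.Under s i (j + 1)) : T.Under s i j := by
  have h1 := line_add_line_mono s hi hj ((T.c !s).y_lt_succ j hj).le
  rw [line_left, line_right hj] at h1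
  unfold Under at *
  linarith

lemma under_mono {s : Bool} {i j j' : ℕ} (hi : i < (T.c s).k) (hjj : j ≤ j') (hj : j' ≤ (T.c !s).k)
    (h : T.Under s i j') : T.Under s i j := by
  induction j', hjj using Nat.le_induction with
  | base => exact h
  | succ m hm ih => exact ih (by omega) (under_of_succ hi (by omega) h)

/-- At the height of the upper end of the edge the chains have not crossed, and below that height
the edge lines only diverge. -/
lemma under_of_y_le {s : Bool} {i j : ℕ} (hi : i < (T.c s).k) (hj : j ≤ (T.c !s).k)
    (h : (T.c !s).y j ≤ (T.c s).y (i + 1)) : T.Under s i j := by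
  have hm : (T.c s).y (i + 1) ≤ T.top := y_le_top hi
  obtain ⟨e, he, h1, h2, hf⟩ := exists_edge (c := T.c !s) (h := (T.c s).y (i + 1))
    (y_nonneg hi) (by rw [T.y_top]; exact hm)
  have h3 := f_add_f_nonpos s (y_nonneg hi) hm
  rw [hf, f_y hi, ← line_right hi] at h3
  rcases Nat.lt_or_ge e j with hej | hej
  · have hje : (T.c !s).y j = (T.c !s).y (e + 1) := le_antisymm (h.trans h2) (y_le hej hj)
    have hle : (T.c !s).y (e + 1) = (T.c s).y (i + 1) := le_antisymm (by rw [← hje]; exact h) h2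
    have : j = e + 1 := by
      by_contra hne
      have : (T.c !s).y (e + 1) < (T.c !s).y j := y_lt (by omega) hj
      linarith
    subst this
    unfold Under
    rw [← line_right he, hle]
    linarith
  · refine under_mono hi hej he.le ?_
    have := line_add_line_mono s hi he h1
    rw [line_left] at this
    unfold Under
    linarith

lemma y_lt_of_not_under {s : Bool} {i j : ℕ} (hi : i < (T.c s).k) (hj : j ≤ (T.c !s).k)
    (h : ¬ T.Under s i j) : (T.c s).y (i + 1) < (T.c !s).y j := by
  by_contra! hc
  exact h (under_of_y_le hi hj hc)

variable (T) in
open Classical in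
/-- The last vertex of the chain `!s` below the extension of the edge `i` of the chain `s`. -/
noncomputable def hit (s : Bool) (i : ℕ) : ℕ :=
  Nat.findGreatest (fun j => T.Under s i j) (T.c !s).k

lemma hit_le (s : Bool) (i : ℕ) : T.hit s i ≤ (T.c !s).k := by
  classical exact Nat.findGreatest_le _

lemma under_zero {s : Bool} {i : ℕ} (hi : i < (T.c s).k) : T.Under s i 0 :=
  under_of_y_le hi (Nat.zero_le _) (by rw [y_zero]; exact y_nonneg hi)

lemma under_hit {s : Bool} {i : ℕ} (hi : i < (T.c s).k) : T.Under s i (T.hit s i) := by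
  classical
  exact Nat.findGreatest_spec (P := fun j => T.Under s i j) (Nat.zero_le _) (under_zero hi)

lemma under_iff {s : Bool} {i j : ℕ} (hi : i < (T.c s).k) (hj : j ≤ (T.c !s).k) :
    T.Under s i j ↔ j ≤ T.hit s i := by
  classical
  exact ⟨fun h => Nat.le_findGreatest hj h, fun h => under_mono hi h (hit_le s i) (under_hit hi)⟩

lemma not_under_of_hit_lt {s : Bool} {i j : ℕ} (hi : i < (T.c s).k) (hj : j ≤ (T.c !s).k)
    (h : T.hit s i < j) : ¬ T.Under s i j := by
  rw [under_iff hi hj]; omega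

/-- The vertex reached from the lower edge, if out of reach of the higher one, would lie above both
edges. There the line of the higher edge is on the left of the other, so its reach cannot be
smaller. -/
lemma hit_mono {s : Bool} {i i' : ℕ} (hii : i ≤ i') (hi : i' < (T.c s).k) :
    T.hit s i ≤ T.hit s i' := by
  have hi0 : i < (T.c s).k := by omega
  by_contra! hc
  have h1 := hit_le (T := T) s i
  have h2 := not_under_of_hit_lt hi h1 hc
  have h3 := y_lt_of_not_under hi h1 h2
  have h4 := under_hit hi0
  have h5 : (T.c s).line i' ((T.c !s).y (T.hit s i)) ≤ (T.c s).line i ((T.c !s).y (T.hit s i)) :=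
    line_le_of_ge hii hi (((T.c s).y_lt_succ i' hi).le.trans h3.le)
  unfold Under at *
  linarith

/-- The extension of the edge starting at `hit s i` ends above the edge `i`. -/
lemma lt_hit_hit {s : Bool} {i : ℕ} (hi : i < (T.c s).k) (hb : T.hit s i < (T.c !s).k) :
    i < T.hit (!s) (T.hit s i) := by
  have h1 := under_hit hi
  have h2 := not_under_of_hit_lt hi hb (Nat.lt_succ_self _)
  have h3 := y_lt_of_not_under hi hb h2
  generalize T.hit s i = b at *
  -- It suffices that the upper end of the edge `i` is itself within reach of the edge `b`. If it is
  -- not below `b`, it faces the edge `b`; otherwise the two lines diverge downwards from `b`.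
  have : T.Under (!s) b (i + 1) := by
    unfold Under at *
    rw [Bool.not_not]
    rcases le_total ((T.c !s).y b) ((T.c s).y (i + 1)) with h | h
    · have h4 := f_add_f_nonpos s (y_nonneg hi) (y_le_top hi)
      rwa [f_y hi, f_eq_line hb h h3.le] at h4
    · have h4 := line_add_line_mono s hi hb h
      rw [line_left, line_right hi] at h4
      linarith
  have := (under_iff hb (by rw [Bool.not_not]; omega)).1 this
  omega

/-- If the extension of an edge reaches the last vertex, then this edge is the last one. -/
lemma succ_eq_of_hit_eq {s : Bool} {i : ℕ} (hi : i < (T.c s).k) (h : T.hit s i = (T.c !s).k) :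
    i + 1 = (T.c s).k := by
  have h1 := under_hit hi
  rw [h] at h1
  unfold Under at h1
  rw [T.y_top, ← T.y_top s] at h1
  have h2 := T.x_top s
  by_contra hne
  have hk : (T.c s).k - 1 + 1 = (T.c s).k := by omega
  have h3 : (T.c s).line ((T.c s).k - 1) ((T.c s).y (T.c s).k) <
      (T.c s).line i ((T.c s).y (T.c s).k) := line_lt_of_gt (by omega) (by omega)
    (y_lt (by omega) le_rfl)
  have h4 := line_right (c := T.c s) (i := (T.c s).k - 1) (by omega)
  rw [hk] at h4
  linarith

/-! ### Points above an extension, and which vertices see them. -/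

variable (T) in
/-- The point `z` is above the extension of the edge `i` of the chain `s`. -/
def Above (s : Bool) (i : ℕ) (z : ℝ × ℝ) : Prop :=
  (T.c s).y i < z.2 ∧ coord s z < (T.c s).line i z.2

lemma sees_of_not_above {s : Bool} {i : ℕ} (hi : i < (T.c s).k) {z : ℝ × ℝ} (hz : T.Mem z)
    (hh : (T.c s).y i ≤ z.2) (h : ¬ T.Above s i z) : T.Sees (T.vertex s i) z := by
  refine sees_up hi hz hh ?_
  rcases hh.eq_or_lt with h1 | h1
  · have := hz.2.2 s
    rw [← h1, line_left]
    rwa [← h1, f_y hi.le] at this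
  · by_contra! hc
    exact h ⟨h1, hc⟩

/-- Successive greedy extensions bound growing parts of the funnel. A counterexample `z` would face
an edge `e` beyond the hit vertex while lying on the right of the line of `i`; moving down to the
lower end of `e` puts that vertex within reach, against the maximality of `hit`. -/
lemma Above.of_hit {s : Bool} {i : ℕ} (hi : i < (T.c s).k) (hb : T.hit s i < (T.c !s).k)
    {z : ℝ × ℝ} (hz : T.Mem z) (h : T.Above (!s) (T.hit s i) z) : T.Above s i z := by
  have h2 := not_under_of_hit_lt hi hb (Nat.lt_succ_self _)
  have h3 := y_lt_of_not_under hi hb h2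
  obtain ⟨ha, hl⟩ := h
  have hz2 := hz.2.2 !s
  have h4 : (T.c !s).y (T.hit s i + 1) < z.2 := by
    by_contra! hc
    rw [f_eq_line hb ha.le hc] at hz2
    linarith
  refine ⟨by linarith [(T.c s).y_lt_succ i hi], ?_⟩
  by_contra! hc
  obtain ⟨e, he, he1, he2, hf⟩ := exists_edge (c := T.c !s) hz.1 (by rw [T.y_top]; exact hz.2.1)
  have heb : T.hit s i < e := by
    have : T.hit s i + 1 < e + 1 := lt_of_y_lt (c := T.c !s) hb (by linarith)
    omega
  apply not_under_of_hit_lt hi he.le heb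
  have h5 := line_add_line_mono s hi he he1
  rw [line_left] at h5
  rw [hf, coord_not] at hz2
  unfold Under
  linarith

lemma not_above_of_succ_eq {s : Bool} {i : ℕ} (hi : i + 1 = (T.c s).k) {z : ℝ × ℝ}
    (hz : T.Mem z) : ¬ T.Above s i z := by
  rintro ⟨h1, h2⟩
  have := hz.2.2 s
  rw [f_eq_line (i := i) (by omega) h1.le (by rw [hi, T.y_top]; exact hz.2.1)] at this
  linarith

/-- A vertex with largest reach sees everything between the two extensions. -/
lemma sees_hit {s : Bool} {i : ℕ} (hi : i < (T.c s).k) (hb : T.hit s i < (T.c !s).k)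
    {z : ℝ × ℝ} (hz : T.Mem z) (h : T.Above s i z) (h' : ¬ T.Above (!s) (T.hit s i) z) :
    T.Sees (T.vertex (!s) (T.hit s i)) z := by
  rcases le_or_gt ((T.c !s).y (T.hit s i)) z.2 with hh | hh
  · exact sees_of_not_above hb hz hh h'
  have hu := under_hit hi
  generalize T.hit s i = m at *
  obtain ⟨b, rfl⟩ : ∃ b, m = b + 1 := by
    refine ⟨m - 1, ?_⟩
    have : 0 < m := lt_of_y_lt (c := T.c !s) (Nat.zero_le _) (by
      rw [y_zero]; exact hz.1.trans_lt hh)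
    omega
  refine Sees.symm (sees_of_sides s ?_ ?_)
  -- The edge of the chain `s` at the height of `z` is not below the edge `i`, so above its lower
  -- end its line is on the left of the line of `i`, and the hit vertex is on the right of both.
  · obtain ⟨e, he, he1, he2, hf⟩ := exists_edge (c := T.c s) hz.1 (by rw [T.y_top]; exact hz.2.1)
    have hie : i ≤ e := by
      have : i < e + 1 := lt_of_y_lt (c := T.c s) hi.le (h.1.trans_le he2)
      omega
    refine clear_of_line he (by rw [← hf]; exact hz.2.2 s) ?_
    rw [coord_vertex_not, vertex_snd]
    have := line_le_of_ge hie he (he1.trans hh.le)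
    unfold Under at hu
    linarith
  -- The edge ending at the hit vertex: its line and the line of `i` diverge downwards from a
  -- nonpositive sum, while `z` is strictly left of the line of `i`.
  · refine clear_of_line (i := b) (by omega) ?_ ?_
    · have := line_add_line_mono s hi (j := b) (by omega) hh.le
      rw [line_right (c := T.c !s) (by omega)] at this
      have h2 := h.2
      unfold Under at hu
      rw [coord_not]
      linarith
    · rw [coord_vertex, vertex_snd, line_right (by omega)]

/-- If `z` sees a vertex, then it sees every lower vertex of the same chain that it is not
above. -/
lemma Sees.of_lt_same {s : Bool} {i i' : ℕ} (hii : i < i') (hi : i' ≤ (T.c s).k) {z : ℝ × ℝ}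
    (hz : T.Mem z) (h : T.Sees z (T.vertex s i')) (ha : ¬ T.Above s i z) :
    T.Sees z (T.vertex s i) := by
  rcases le_or_gt ((T.c s).y i) z.2 with hh | hh
  · exact (sees_of_not_above (by omega) hz hh ha).symm
  have hy := y_lt hii hi
  obtain ⟨p, rfl⟩ : ∃ p, i = p + 1 := by
    refine ⟨i - 1, ?_⟩
    have : 0 < i := lt_of_y_lt (c := T.c s) (Nat.zero_le _) (by
      rw [y_zero]; exact hz.1.trans_lt hh)
    omega
  obtain ⟨p', rfl⟩ : ∃ p, i' = p + 1 := ⟨i' - 1, by omega⟩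
  refine sees_of_sides s ?_ ?_
  · have h1 := h.line_le_of_lt (i := p') (by omega) (by linarith)
    have h2 : (T.c s).line p z.2 ≤ (T.c s).line p' z.2 := line_le_of_le (by omega) (by omega) hh.le
    refine clear_of_line (i := p) (by omega) (h2.trans h1) ?_
    rw [coord_vertex, vertex_snd, line_right (by omega)]
  -- The sightline to the higher vertex passes on the right of the lower one, so the sightline to
  -- the lower vertex is farther from the opposite chain.
  · have h1 := (h s).at_height (η := (T.c s).y (p + 1)) hh.le hy.le (by rw [vertex_snd]; linarith)
    rw [f_y (by omega)] at h1
    refine (h !s).mono hh.le hy.le (by rw [vertex_snd]; linarith) ?_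
    rw [coord_vertex, vertex_snd] at h1
    rw [coord_not_vertex, coord_not_vertex, coord_not]
    simp only [vertex_snd]
    linarith

/-- If `z` sees a vertex above the extension of the upper edge at the vertex `b` of the other
chain, then it sees `b` unless it is above this extension. -/
lemma Sees.of_lt_other {s : Bool} {b i : ℕ} (hb : b < (T.c !s).k) (hi : i ≤ (T.c s).k)
    (hbi : T.hit (!s) b < i) {z : ℝ × ℝ} (hz : T.Mem z) (h : T.Sees z (T.vertex s i))
    (ha : ¬ T.Above (!s) b z) : T.Sees z (T.vertex (!s) b) := by
  rcases le_or_gt ((T.c !s).y b) z.2 with hh | hh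
  · exact (sees_of_not_above hb hz hh ha).symm
  have hu := not_under_of_hit_lt hb (by rw [Bool.not_not]; exact hi) hbi
  have hy := y_lt_of_not_under hb (by rw [Bool.not_not]; exact hi) hu
  rw [Bool.not_not] at hy
  have hy' := (T.c !s).y_lt_succ b hb
  obtain ⟨p, rfl⟩ : ∃ p, b = p + 1 := by
    refine ⟨b - 1, ?_⟩
    have : 0 < b := lt_of_y_lt (c := T.c !s) (Nat.zero_le _) (by
      rw [y_zero]; exact hz.1.trans_lt hh)
    omega
  have hlt : z.2 < (T.vertex s i).2 := by rw [vertex_snd]; linarith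
  have hle : (T.c !s).y (p + 1) ≤ (T.vertex s i).2 := by rw [vertex_snd]; linarith
  have h1 := (h !s).at_height hh.le hle hlt
  rw [f_y (by omega), coord_not_vertex, coord_not, vertex_snd] at h1
  refine sees_of_sides s ?_ ?_
  · refine (h s).mono hh.le hle hlt ?_
    rw [coord_vertex_not, coord_vertex]
    simp only [vertex_snd]
    linarith
  · refine clear_of_line (i := p) (by omega) ?_ ?_
    -- Otherwise both ends of the sightline from `z` to the vertex `i` are strictly beyond the line
    -- of the edge `p`, so the sightline misses the vertex `p + 1` on the wrong side, contrary to
    -- `h1`.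
    · by_contra! hc
      apply hu
      unfold Under
      rw [Bool.not_not]
      have h2 : (T.c !s).line (p + 1) ((T.c s).y i) ≤ (T.c !s).line p ((T.c s).y i) :=
        line_le_of_ge (by omega) hb (by linarith)
      have e1 := line_sub_line (c := T.c !s) p z.2 ((T.c !s).y (p + 1))
      have e2 := line_sub_line (c := T.c !s) p ((T.c s).y i) ((T.c !s).y (p + 1))
      rw [line_right (by omega)] at e1 e2
      rw [coord_not] at hc
      suffices (T.c s).x i + (T.c !s).line p ((T.c s).y i) ≤ 0 by linarith
      by_contra! hc'
      have hA : 0 < (T.c s).y i - (T.c !s).y (p + 1) := by linarith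
      have hB : 0 < (T.c !s).y (p + 1) - z.2 := by linarith
      have p1 : 0 < ((T.c !s).line p z.2 + coord s z) * ((T.c s).y i - (T.c !s).y (p + 1)) :=
        mul_pos (by linarith) hA
      have p2 : 0 < ((T.c s).x i + (T.c !s).line p ((T.c s).y i)) * ((T.c !s).y (p + 1) - z.2) :=
        mul_pos hc' hB
      rw [show (T.c !s).line p z.2 = (T.c !s).x (p + 1) +
        (T.c !s).slope p * (z.2 - (T.c !s).y (p + 1)) by linarith] at p1
      rw [show (T.c !s).line p ((T.c s).y i) = (T.c !s).x (p + 1) +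
        (T.c !s).slope p * ((T.c s).y i - (T.c !s).y (p + 1)) by linarith] at p2
      nlinarith
    · rw [coord_vertex, vertex_snd, line_right (by omega)]

end TwoChains

/-! ### A ruler coloring -/

/-- A variant of the ruler sequence `1, 3, 2, 4, 1, 3, 2, 5, …`, in which consecutive elements of
lowest rank have different colors. -/
def rulerColor (k : ℕ) : ℕ :=
  if k % 4 = 0 then 1 else if k % 4 = 1 then 3 else if k % 4 = 2 then 2
  else rulerColor (k / 2) + 1

lemma rulerColor_zero (q : ℕ) : rulerColor (4 * q) = 1 := by
  rw [rulerColor, if_pos (by omega)]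

lemma rulerColor_one (q : ℕ) : rulerColor (4 * q + 1) = 3 := by
  rw [rulerColor, if_neg (by omega), if_pos (by omega)]

lemma rulerColor_two (q : ℕ) : rulerColor (4 * q + 2) = 2 := by
  rw [rulerColor, if_neg (by omega), if_neg (by omega), if_pos (by omega)]

lemma rulerColor_three (q : ℕ) : rulerColor (4 * q + 3) = rulerColor (2 * q + 1) + 1 := by
  rw [rulerColor, if_neg (by omega), if_neg (by omega), if_neg (by omega),
    show (4 * q + 3) / 2 = 2 * q + 1 by omega]

lemma exists_four (k : ℕ) : ∃ q, k = 4 * q ∨ k = 4 * q + 1 ∨ k = 4 * q + 2 ∨ k = 4 * q + 3 :=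
  ⟨k / 4, by omega⟩

lemma rulerColor_pos (k : ℕ) : 0 < rulerColor k := by
  obtain ⟨q, rfl | rfl | rfl | rfl⟩ := exists_four k
  · rw [rulerColor_zero]; omega
  · rw [rulerColor_one]; omega
  · rw [rulerColor_two]; omega
  · rw [rulerColor_three]; omega

lemma three_le_rulerColor_odd (m : ℕ) : 3 ≤ rulerColor (2 * m + 1) := by
  induction m using Nat.strong_induction_on with
  | _ m ih =>
    obtain ⟨q, rfl | rfl⟩ := Nat.even_or_odd' m
    · rw [show 2 * (2 * q) + 1 = 4 * q + 1 by ring, rulerColor_one]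
    · rw [show 2 * (2 * q + 1) + 1 = 4 * q + 3 by ring, rulerColor_three]
      have := ih q (by omega)
      omega

lemma rulerColor_even_le (m : ℕ) : rulerColor (2 * m) ≤ 2 := by
  obtain ⟨q, rfl | rfl⟩ := Nat.even_or_odd' m
  · rw [show 2 * (2 * q) = 4 * q by ring, rulerColor_zero]; omega
  · rw [show 2 * (2 * q + 1) = 4 * q + 2 by ring, rulerColor_two]

/-- Each recursive step halves the index and costs one color. The constant 2 is attained at index 1,
whose color is 3. -/
lemma rulerColor_le (k : ℕ) : rulerColor k ≤ Nat.log 2 (k + 1) + 2 := by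
  induction k using Nat.strong_induction_on with
  | _ k ih =>
    obtain ⟨q, rfl | rfl | rfl | rfl⟩ := exists_four k
    · rw [rulerColor_zero]; omega
    · rw [rulerColor_one]
      have : 1 ≤ Nat.log 2 (4 * q + 1 + 1) := Nat.log_pos (by omega) (by omega)
      omega
    · rw [rulerColor_two]; omega
    · have h1 := ih (2 * q + 1) (by omega)
      rw [rulerColor_three, show 4 * q + 3 + 1 = (2 * q + 1 + 1) * 2 by ring,
        Nat.log_mul_base (by omega) (by omega)]
      omega

/-- On the odd positions the recursion is that of the ordinary ruler sequence: every other element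
has the least color 3, and the remaining ones repeat the sequence with colors raised by one. -/
lemma exists_larger_odd (a b : ℕ) (hab : a < b)
    (h : rulerColor (2 * a + 1) = rulerColor (2 * b + 1)) :
    ∃ c, a < c ∧ c < b ∧ rulerColor (2 * a + 1) < rulerColor (2 * c + 1) := by
  induction b using Nat.strong_induction_on generalizing a with
  | _ b ih =>
    obtain ⟨q, rfl | rfl⟩ := Nat.even_or_odd' a <;> obtain ⟨r, rfl | rfl⟩ := Nat.even_or_odd' b
    · refine ⟨2 * q + 1, by omega, by omega, ?_⟩
      rw [show 2 * (2 * q) + 1 = 4 * q + 1 by ring, rulerColor_one,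
        show 2 * (2 * q + 1) + 1 = 4 * q + 3 by ring, rulerColor_three]
      have := three_le_rulerColor_odd q
      omega
    · rw [show 2 * (2 * q) + 1 = 4 * q + 1 by ring, rulerColor_one,
        show 2 * (2 * r + 1) + 1 = 4 * r + 3 by ring, rulerColor_three] at h
      have := three_le_rulerColor_odd r
      omega
    · rw [show 2 * (2 * r) + 1 = 4 * r + 1 by ring, rulerColor_one,
        show 2 * (2 * q + 1) + 1 = 4 * q + 3 by ring, rulerColor_three] at h
      have := three_le_rulerColor_odd q
      omega
    · rw [show 2 * (2 * r + 1) + 1 = 4 * r + 3 by ring, rulerColor_three,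
        show 2 * (2 * q + 1) + 1 = 4 * q + 3 by ring, rulerColor_three] at h
      obtain ⟨c, h1, h2, h3⟩ := ih r (by omega) q (by omega) (by omega)
      refine ⟨2 * c + 1, by omega, by omega, ?_⟩
      rw [show 2 * (2 * c + 1) + 1 = 4 * c + 3 by ring, rulerColor_three,
        show 2 * (2 * q + 1) + 1 = 4 * q + 3 by ring, rulerColor_three]
      omega

/-- Between two elements of equal color there is one of larger color, and not just directly before
the second of them. -/
lemma exists_larger {a b : ℕ} (hab : a < b) (h : rulerColor a = rulerColor b) :
    ∃ c, a < c ∧ c + 1 < b ∧ rulerColor a < rulerColor c := by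
  obtain ⟨q, rfl | rfl⟩ := Nat.even_or_odd' a <;> obtain ⟨r, rfl | rfl⟩ := Nat.even_or_odd' b
  -- The odd neighbor would be directly before the second element only if the two even positions
  -- were consecutive, but those alternate between the colors 1 and 2.
  · refine ⟨2 * q + 1, by omega, ?_, ?_⟩
    · rcases Nat.lt_or_ge (q + 1) r with h1 | h1
      · omega
      · have : r = q + 1 := by omega
        subst this
        obtain ⟨p, rfl | rfl⟩ := Nat.even_or_odd' q
        · rw [show 2 * (2 * p) = 4 * p by ring, show 2 * (2 * p + 1) = 4 * p + 2 by ring,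
            rulerColor_zero, rulerColor_two] at h
          omega
        · rw [show 2 * (2 * p + 1) = 4 * p + 2 by ring,
            show 2 * (2 * p + 1 + 1) = 4 * (p + 1) by ring, rulerColor_zero, rulerColor_two] at h
          omega
    · have := three_le_rulerColor_odd q
      have := rulerColor_even_le q
      omega
  · have := three_le_rulerColor_odd r
    have := rulerColor_even_le q
    omega
  · have := three_le_rulerColor_odd q
    have := rulerColor_even_le r
    omega
  · obtain ⟨c, h1, h2, h3⟩ := exists_larger_odd q r (by omega) h
    exact ⟨2 * c + 1, by omega, by omega, h3⟩

/-- The ruler coloring is conflict-free for intervals in which the last but one element may be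
missing. -/
lemma exists_unique_color (V : Finset ℕ) (a : ℕ) (ha : a ∈ V) (hmin : ∀ m ∈ V, a ≤ m)
    (hV : ∀ k ∈ V, ∀ m, a ≤ m → m < k → m + 1 ≠ k → m ∈ V) :
    ∃ k ∈ V, ∀ k' ∈ V, rulerColor k' = rulerColor k → k' = k := by
  -- The largest color in `V` is the unique one: a repetition would enclose a larger color at a
  -- position that `hV` forces into `V`.
  obtain ⟨k, hk, hmax⟩ := V.exists_max_image rulerColor ⟨a, ha⟩
  refine ⟨k, hk, fun k' hk' h => ?_⟩
  by_contra hne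
  wlog hlt : k < k' generalizing k k'
  · exact this k' hk' (fun x hx => h ▸ hmax x hx) k hk h.symm (Ne.symm hne) (by omega)
  obtain ⟨c, h1, h2, h3⟩ := exists_larger hlt h.symm
  have := hmax c (hV k' hk' c ((hmin k hk).trans h1.le) (by omega) (by omega))
  omega

/-! ### The greedy sequence of guards -/

/-- The side of the guard number `k`. -/
def side : ℕ → Bool
  | 0 => true
  | k + 1 => !side k

lemma side_eq (k : ℕ) : side k = decide (k % 2 = 0) := by
  induction k with
  | zero => rfl
  | succ k ih =>
    rw [side, ih, ← decide_not, decide_eq_decide]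
    omega

namespace TwoChains

open ConcaveChain

variable (T : TwoChains)

/-- The guard number `k` is the vertex `T.guard k` of the chain `side k`. -/
noncomputable def guard : ℕ → ℕ
  | 0 => 0
  | k + 1 => T.hit (side k) (guard k)

variable {T}

lemma guard_lt_add_two {k : ℕ} (h0 : T.guard k < (T.c (side k)).k)
    (h1 : T.guard (k + 1) < (T.c (side (k + 1))).k) : T.guard k < T.guard (k + 2) :=
  lt_hit_hit h0 h1

lemma guard_le (k : ℕ) : T.guard k ≤ (T.c (side k)).k := by
  cases k with
  | zero => exact Nat.zero_le _
  | succ k => exact hit_le _ _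

variable (T) in
-- Every second guard is on the same chain and strictly higher, so the sequence cannot continue
-- forever.
lemma exists_guard_top : ∃ k, ¬ T.guard k < (T.c (side k)).k := by
  by_contra! hc
  have : ∀ m, m ≤ T.guard (2 * m) := by
    intro m
    induction m with
    | zero => exact Nat.zero_le _
    | succ m ih => exact lt_of_le_of_lt ih (guard_lt_add_two (hc _) (hc _))
  have h1 := this (T.c true).k
  have h2 := hc (2 * (T.c true).k)
  have h3 : side (2 * (T.c true).k) = true := by rw [side_eq]; simp
  rw [h3] at h2
  omega

open Classical in
variable (T) in
/-- The number of greedy guards. -/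
noncomputable def count : ℕ := Nat.find T.exists_guard_top

lemma guard_lt {k : ℕ} (h : k < T.count) : T.guard k < (T.c (side k)).k := by
  classical
  exact not_not.1 (Nat.find_min T.exists_guard_top h)

lemma guard_count : T.guard T.count = (T.c (side T.count)).k := by
  classical
  exact le_antisymm (guard_le _) (not_lt.1 (Nat.find_spec T.exists_guard_top))

lemma count_pos : 0 < T.count := by
  by_contra! h
  have h1 := guard_count (T := T)
  rw [Nat.le_zero.1 h] at h1
  exact (T.c true).k_pos.ne h1

lemma guard_strictMono {k m : ℕ} (hkm : k < m) (hm : m ≤ T.count) (hp : k % 2 = m % 2) :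
    T.guard k < T.guard m := by
  obtain ⟨d, rfl⟩ : ∃ d, m = k + 2 * d + 2 := ⟨(m - k) / 2 - 1, by omega⟩
  induction d with
  | zero => exact guard_lt_add_two (guard_lt (by omega)) (guard_lt (by omega))
  | succ d ih =>
    refine (ih (by omega) (by omega) (by omega)).trans ?_
    exact guard_lt_add_two (guard_lt (by omega)) (guard_lt (by omega))

lemma guard_mono {k m : ℕ} (hkm : k ≤ m) (hm : m ≤ T.count) (hp : k % 2 = m % 2) :
    T.guard k ≤ T.guard m := by
  rcases hkm.eq_or_lt with rfl | h
  · exact le_rfl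
  · exact (guard_strictMono h hm hp).le

lemma le_guard_two_mul {m : ℕ} (hm : 2 * m ≤ T.count) : m ≤ T.guard (2 * m) := by
  induction m with
  | zero => exact Nat.zero_le _
  | succ m ih =>
    have h1 := ih (by omega)
    have h2 := guard_strictMono (T := T) (k := 2 * m) (m := 2 * (m + 1)) (by omega) hm (by omega)
    omega

lemma count_le : T.count ≤ 2 * (T.c true).k := by
  by_contra! hc
  have h1 := le_guard_two_mul (T := T) hc.le
  have h2 := guard_lt hc
  rw [show side (2 * (T.c true).k) = true by rw [side_eq]; simp] at h2
  omega

/-- Iterates the contrapositive of `Above.of_hit`. -/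
lemma not_above_mono {k m : ℕ} (hkm : k ≤ m) (hm : m < T.count) {z : ℝ × ℝ} (hz : T.Mem z)
    (h : ¬ T.Above (side k) (T.guard k) z) : ¬ T.Above (side m) (T.guard m) z := by
  induction m, hkm using Nat.le_induction with
  | base => exact h
  | succ m hkm ih =>
    exact fun H => ih (by omega) (Above.of_hit (s := side m) (i := T.guard m)
      (guard_lt (by omega)) (guard_lt hm) hz H)

/-- Take the first extension that `z` is not above. It exists because the last guard starts the
final edge of its chain; the guard there sees `z` by `sees_hit`, or directly if it is the bottom
vertex. -/
lemma exists_first_guard {z : ℝ × ℝ} (hz : T.Mem z) :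
    ∃ k, k < T.count ∧ ¬ T.Above (side k) (T.guard k) z ∧
      T.Sees (T.vertex (side k) (T.guard k)) z ∧
      ∀ m < k, ¬ T.Sees (T.vertex (side m) (T.guard m)) z := by
  classical
  have hpos := T.count_pos
  have hlast : ¬ T.Above (side (T.count - 1)) (T.guard (T.count - 1)) z := by
    have h1 := guard_count (T := T)
    obtain ⟨m, hm⟩ : ∃ m, T.count = m + 1 := ⟨T.count - 1, by omega⟩
    rw [hm] at h1 ⊢
    exact not_above_of_succ_eq (succ_eq_of_hit_eq (s := side m) (i := T.guard m)
      (guard_lt (by omega)) h1) hz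
  have hex : ∃ k, ¬ T.Above (side k) (T.guard k) z := ⟨_, hlast⟩
  have hlt : Nat.find hex < T.count := lt_of_le_of_lt (Nat.find_min' hex hlast) (by omega)
  have hspec := Nat.find_spec hex
  have hbelow : ∀ m < Nat.find hex, T.Above (side m) (T.guard m) z :=
    fun m hm => not_not.1 (Nat.find_min hex hm)
  generalize Nat.find hex = k at *
  refine ⟨k, hlt, hspec, ?_, fun m hm => ?_⟩
  · cases k with
    | zero => exact sees_of_not_above (guard_lt hlt) hz (by
        show (T.c true).y 0 ≤ z.2
        rw [y_zero]; exact hz.1) hspec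
    | succ k => 
      exact sees_hit (s := side k) (i := T.guard k) (guard_lt (by omega)) (guard_lt hlt) hz
        (hbelow k (by omega)) hspec
  · exact not_sees_up (guard_lt (by omega)) (hbelow m hm).1 (hbelow m hm).2

/-- Parity decides whether the two guards share a chain. If they do not, `Sees.of_lt_other` needs
guard `k` strictly above the reach of guard `m`. That reach is guard `m + 1` itself, which is why
the last but one guard is exempt. -/
lemma sees_guard_of_sees {k₀ m k : ℕ} {z : ℝ × ℝ} (hz : T.Mem z)
    (h0 : ¬ T.Above (side k₀) (T.guard k₀) z) (hm : k₀ ≤ m) (hmk : m < k) (hne : m + 1 ≠ k)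
    (hk : k < T.count) (hs : T.Sees z (T.vertex (side k) (T.guard k))) :
    T.Sees z (T.vertex (side m) (T.guard m)) := by
  have ha := not_above_mono hm (by omega) hz h0
  rcases Nat.lt_or_ge ((k - m) % 2) 1 with hp | hp
  · have hsd : side k = side m := by rw [side_eq, side_eq, decide_eq_decide]; omega
    have hg := guard_strictMono (T := T) hmk hk.le (by omega)
    rw [hsd] at hs
    have := guard_lt hk
    rw [hsd] at this
    exact hs.of_lt_same hg this.le hz ha
  · have hsd : side m = !side k := by
      rw [side_eq, side_eq, ← decide_not, decide_eq_decide]; omega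
    have hg := guard_strictMono (T := T) (k := m + 1) (m := k) (by omega) hk.le (by omega)
    have hg' : T.guard (m + 1) = T.hit (side m) (T.guard m) := rfl
    have hl := guard_lt (T := T) (k := m) (by omega)
    rw [hg'] at hg
    rw [hsd] at hg hl ha ⊢
    exact hs.of_lt_other hl (guard_lt hk).le hg hz ha

/-- The ruler coloring of the greedy guards is conflict-free. -/
theorem exists_unique_guard {z : ℝ × ℝ} (hz : T.Mem z) :
    ∃ k < T.count, T.Sees z (T.vertex (side k) (T.guard k)) ∧
      ∀ k' < T.count, T.Sees z (T.vertex (side k') (T.guard k')) →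
        rulerColor k' = rulerColor k → k' = k := by
  classical
  obtain ⟨k₀, hk₀, ha, hs, hn⟩ := exists_first_guard hz
  obtain ⟨k, hk, hu⟩ := exists_unique_color
    ((Finset.range T.count).filter fun k => T.Sees z (T.vertex (side k) (T.guard k))) k₀
    (by simp [hk₀, hs.symm])
    (by
      intro m hm
      by_contra! hc
      exact hn m hc (Finset.mem_filter.1 hm).2.symm)
    (by
      intro k hk m h1 h2 h3
      rw [Finset.mem_filter, Finset.mem_range] at hk ⊢
      exact ⟨by omega, sees_guard_of_sees hz ha h1 h2 h3 hk.1 hk.2⟩)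
  rw [Finset.mem_filter, Finset.mem_range] at hk
  exact ⟨k, hk.1, hk.2, fun k' h1 h2 => hu k' (by simp [h1, h2])⟩

end TwoChains

/-! ### The lower bound on the number of colors -/

namespace TwoChains

open ConcaveChain

variable {T : TwoChains}

/-- The point with height `h` and abscissa `X` as measured from the side `s`. -/
def point (s : Bool) (X h : ℝ) : ℝ × ℝ := (if s then X else -X, h)

lemma coord_point (s : Bool) (X h : ℝ) : coord s (point s X h) = X := by
  cases s <;> simp [coord, point]

lemma exists_crossing {s : Bool} {i j : ℕ} (hij : i < j) (hj : j < (T.c s).k) :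
    ∃ z : ℝ × ℝ, (T.c s).y (i + 1) ≤ z.2 ∧ z.2 ≤ (T.c s).y j ∧
      coord s z = (T.c s).line i z.2 ∧ coord s z = (T.c s).line j z.2 := by
  have hi : i < (T.c s).k := by omega
  have hle : (T.c s).y (i + 1) ≤ (T.c s).y j := y_le hij hj.le
  have h1 : (T.c s).line i ((T.c s).y (i + 1)) ≤ (T.c s).line j ((T.c s).y (i + 1)) :=
    line_le_of_le hij.le hj le_rfl
  have h2 : (T.c s).line j ((T.c s).y j) ≤ (T.c s).line i ((T.c s).y j) :=
    line_le_of_ge hij.le hj le_rfl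
  obtain ⟨h, ⟨ha, hb⟩, hh⟩ := intermediate_value_Icc hle
    (f := fun h => (T.c s).line i h - (T.c s).line j h)
    ((continuous_line i).sub (continuous_line j)).continuousOn
    (show (0 : ℝ) ∈ Set.Icc _ _ from ⟨by linarith, by linarith⟩)
  refine ⟨point s ((T.c s).line i h) h, ha, hb, coord_point s _ _, ?_⟩
  rw [coord_point]
  show (T.c s).line i h = (T.c s).line j h
  have : (T.c s).line i h - (T.c s).line j h = 0 := hh
  linarith

/-- A single edge line of the opposite chain that does not cross the line of `j` up to the top of
the edge `j`; it certifies that sightlines near that line avoid the opposite chain. -/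
lemma exists_edge_line_nonpos {s : Bool} {j : ℕ} (hj : j < (T.c s).k) :
    ∃ e < (T.c !s).k, ∀ h ≤ (T.c s).y (j + 1), (T.c s).line j h + (T.c !s).line e h ≤ 0 := by
  obtain ⟨e, he, -, -, hf⟩ := exists_edge (c := T.c !s) (h := (T.c s).y (j + 1)) (y_nonneg hj)
    (by rw [T.y_top]; exact y_le_top hj)
  refine ⟨e, he, fun h hh => (line_add_line_mono s hj he hh).trans ?_⟩
  rw [line_right hj, ← hf, ← f_y (c := T.c s) hj]
  exact f_add_f_nonpos s (y_nonneg hj) (y_le_top hj)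

/-! ### Visibility from the crossing of two edge lines of one chain. -/

section Crossing

variable {s : Bool} {i j : ℕ} {z : ℝ × ℝ}

lemma mem_crossing (hij : i < j) (hj : j < (T.c s).k) (h1 : (T.c s).y (i + 1) ≤ z.2)
    (h2 : z.2 ≤ (T.c s).y j) (hzi : coord s z = (T.c s).line i z.2)
    (hzj : coord s z = (T.c s).line j z.2) : T.Mem z := by
  refine ⟨(y_nonneg (by omega)).trans h1, h2.trans (y_le_top hj.le), fun s' => ?_⟩
  rcases Bool.eq_or_eq_not s' s with rfl | rfl
  · rw [hzi]; exact f_le_line (by omega) _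
  · obtain ⟨e, he, hs⟩ := exists_edge_line_nonpos hj
    have := hs z.2 (h2.trans ((T.c s).y_lt_succ j hj).le)
    have := f_le_line he z.2
    rw [coord_not, hzj]
    linarith

lemma not_sees_below_crossing (hij : i < j) (hj : j < (T.c s).k) (h1 : (T.c s).y (i + 1) ≤ z.2)
    (hzi : coord s z = (T.c s).line i z.2) {p : ℕ} (hp : p < i) : ¬ T.Sees z (T.vertex s p) := by
  have hy := (T.c s).y_lt_succ i (by omega)
  have hy' : (T.c s).y p < (T.c s).y i := y_lt hp (by omega)
  intro H
  refine not_sees_up (i := p) (by omega) (by linarith) ?_ H.symm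
  rw [hzi]
  exact line_lt_of_gt hp (by omega) (by linarith)

lemma not_sees_above_crossing (h2 : z.2 ≤ (T.c s).y j)
    (hzj : coord s z = (T.c s).line j z.2) {p : ℕ} (hp : j + 1 < p) (hpk : p ≤ (T.c s).k) :
    ¬ T.Sees z (T.vertex s p) := by
  obtain ⟨p, rfl⟩ : ∃ q, p = q + 1 := ⟨p - 1, by omega⟩
  have hy := (T.c s).y_lt_succ j (by omega)
  have hy' : (T.c s).y (j + 1) < (T.c s).y (p + 1) := y_lt (by omega) (by omega)
  intro H
  have h3 := H.line_le_of_lt (by omega) (by linarith)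
  have h4 : (T.c s).line j z.2 < (T.c s).line p z.2 :=
    line_lt_of_lt (by omega) (by omega) (by linarith)
  linarith

/-- The extension of the edge `r₀` passes below the edge `i + 1` end point, hence below `z` on the
line of `i`; so `z` is beyond the extensions of all edges up to `r₀` on that chain. -/
lemma not_sees_other_below_crossing (hij : i < j) (hj : j < (T.c s).k)
    (h1 : (T.c s).y (i + 1) ≤ z.2) (hzi : coord s z = (T.c s).line i z.2) {r r₀ : ℕ}
    (hr : r ≤ r₀) (hr₀ : r₀ < (T.c !s).k) (hhit : T.hit (!s) r₀ = i) :
    ¬ T.Sees z (T.vertex (!s) r) := by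
  have hik : i + 1 ≤ (T.c !!s).k := by rw [Bool.not_not]; omega
  have hu := not_under_of_hit_lt hr₀ hik (by omega)
  have hy := y_lt_of_not_under hr₀ hik hu
  rw [Bool.not_not] at hy
  unfold Under at hu
  rw [Bool.not_not, ← line_right (c := T.c s) (by omega)] at hu
  have h3 := line_add_line_mono s (by omega : i < (T.c s).k) hr₀ h1
  have hy1 := (T.c !s).y_lt_succ r₀ hr₀
  have hy2 : (T.c !s).y r ≤ (T.c !s).y r₀ := y_le hr hr₀.le
  have h4 : (T.c !s).line r₀ z.2 ≤ (T.c !s).line r z.2 := line_le_of_ge hr hr₀ (by linarith)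
  intro H
  refine not_sees_up (s := !s) (i := r) (by omega) (by linarith) ?_ H.symm
  rw [coord_not, hzi]
  linarith

/-- The point `z` is on the line of `j` and the vertex `r` strictly beyond it, so at the height of
the vertex `j + 1` the sightline is on the wrong side of that vertex. -/
lemma not_sees_other_above_crossing (hj : j < (T.c s).k) (h2 : z.2 ≤ (T.c s).y j)
    (hzj : coord s z = (T.c s).line j z.2) {r : ℕ} (hr : T.hit s j < r) (hrk : r ≤ (T.c !s).k) :
    ¬ T.Sees z (T.vertex (!s) r) := by
  intro H
  have hu := not_under_of_hit_lt hj hrk hr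
  have hy := y_lt_of_not_under hj hrk hu
  have hy' := (T.c s).y_lt_succ j hj
  have h3 := (H s).at_height (η := (T.c s).y (j + 1)) (by linarith) hy.le
    (by rw [vertex_snd]; linarith)
  rw [f_y hj, coord_vertex_not, vertex_snd, hzj] at h3
  unfold Under at hu
  have e1 := line_sub_line (c := T.c s) j z.2 ((T.c s).y (j + 1))
  have e2 := line_sub_line (c := T.c s) j ((T.c !s).y r) ((T.c s).y (j + 1))
  rw [line_right hj] at e1 e2
  have p1 : 0 < ((T.c !s).x r + (T.c s).line j ((T.c !s).y r)) * ((T.c s).y (j + 1) - z.2) :=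
    mul_pos (by linarith) (by linarith)
  rw [show (T.c s).line j z.2 = (T.c s).x (j + 1) +
    (T.c s).slope j * (z.2 - (T.c s).y (j + 1)) by linarith] at h3
  rw [show (T.c s).line j ((T.c !s).y r) = (T.c s).x (j + 1) +
    (T.c s).slope j * ((T.c !s).y r - (T.c s).y (j + 1)) by linarith] at p1
  nlinarith

lemma sees_crossing (hij : i < j) (hj : j < (T.c s).k) (h1 : (T.c s).y (i + 1) ≤ z.2)
    (h2 : z.2 ≤ (T.c s).y j) (hzi : coord s z = (T.c s).line i z.2)
    (hzj : coord s z = (T.c s).line j z.2) {p : ℕ} (hip : i ≤ p) (hpj : p ≤ j + 1) :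
    T.Sees z (T.vertex s p) := by
  have hyj := (T.c s).y_lt_succ j hj
  rcases le_or_gt ((T.c s).y p) z.2 with hh | hh
  · have hpk : p < (T.c s).k := by
      have : p < j + 1 := lt_of_y_lt (c := T.c s) (by omega) (by linarith)
      omega
    refine (sees_up hpk (mem_crossing hij hj h1 h2 hzi hzj) hh ?_).symm
    rw [hzi]
    exact line_le_of_ge hip hpk hh
  · have : i + 1 < p := lt_of_y_lt (c := T.c s) (by omega) (by linarith)
    obtain ⟨q, rfl⟩ : ∃ q, p = q + 1 := ⟨p - 1, by omega⟩
    obtain ⟨e, he, hs⟩ := exists_edge_line_nonpos hj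
    refine sees_of_sides s (clear_of_line (i := q) (by omega) ?_ ?_) (clear_of_line he ?_ ?_)
    · rw [hzj]
      exact line_le_of_le (by omega) hj hh.le
    · rw [coord_vertex, vertex_snd, line_right (by omega)]
    · have := hs z.2 (by linarith)
      rw [coord_not, hzj]
      linarith
    · have h3 := hs ((T.c s).y (q + 1)) (y_le (by omega) (by omega))
      have h4 : (T.c s).x (q + 1) ≤ (T.c s).line j ((T.c s).y (q + 1)) := x_le_line hj (by omega)
      rw [coord_not_vertex, vertex_snd]
      linarith

/-- Such a vertex lies between the two lines, in the wedge above their crossing, and so is higher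
than `z`. -/
lemma sees_other_crossing (hij : i < j) (hj : j < (T.c s).k)
    (hzi : coord s z = (T.c s).line i z.2) (hzj : coord s z = (T.c s).line j z.2) {r : ℕ}
    (hir : T.hit s i < r) (hrj : r ≤ T.hit s j) : T.Sees z (T.vertex (!s) r) := by
  have hrk : r ≤ (T.c !s).k := hrj.trans (hit_le s j)
  have hu := (under_iff hj hrk).2 hrj
  have hu' := not_under_of_hit_lt (by omega) hrk hir
  unfold Under at hu hu'
  have hy : z.2 < (T.c !s).y r := by
    by_contra! hc
    have e1 := line_sub_line (c := T.c s) i z.2 ((T.c !s).y r)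
    have e2 := line_sub_line (c := T.c s) j z.2 ((T.c !s).y r)
    have := mul_nonneg (sub_nonneg.2 (slope_lt_slope hij hj).le) (sub_nonneg.2 hc)
    linarith
  obtain ⟨q, rfl⟩ : ∃ q, r = q + 1 := ⟨r - 1, by omega⟩
  refine sees_of_sides s (clear_of_line hj hzj.ge ?_) (clear_of_line (i := q) (by omega) ?_ ?_)
  · rw [coord_vertex_not, vertex_snd]
    linarith
  · have := line_add_line_mono s hj (j := q) (by omega) hy.le
    rw [line_right (c := T.c !s) (by omega)] at this
    rw [coord_not, hzj]
    linarith
  · rw [coord_vertex, vertex_snd, line_right (by omega)]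

end Crossing

lemma side_two_mul (a : ℕ) : side (2 * a) = true := by rw [side_eq]; simp

lemma side_two_mul_add_one (a : ℕ) : side (2 * a + 1) = false := by rw [side_eq]; simp

lemma guard_even_lt {a : ℕ} (h : 2 * a < T.count) : T.guard (2 * a) < (T.c true).k := by
  have := guard_lt h
  rwa [side_two_mul] at this

lemma guard_odd_lt {a : ℕ} (h : 2 * a + 1 < T.count) : T.guard (2 * a + 1) < (T.c false).k := by
  have := guard_lt h
  rwa [side_two_mul_add_one] at this

lemma guard_odd (a : ℕ) : T.guard (2 * a + 1) = T.hit true (T.guard (2 * a)) := by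
  rw [guard, side_two_mul]

lemma guard_even_succ (a : ℕ) : T.guard (2 * a + 2) = T.hit false (T.guard (2 * a + 1)) := by
  rw [guard, side_two_mul_add_one]

/-! ### Zones between greedy guards, and their witness points. -/

variable (T) in
/-- The vertices in the zones with number at least `a`. -/
def Low (a : ℕ) (s : Bool) (p : ℕ) : Prop :=
  match s with
  | true => T.guard (2 * a) ≤ p
  | false => a = 0 ∨ T.guard (2 * a - 1) < p

variable (T) in
/-- The vertices in the zones with number at most `b`. -/
def High (b : ℕ) (s : Bool) (p : ℕ) : Prop :=
  match s with
  | true => p ≤ T.guard (2 * b)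
  | false => p ≤ T.hit true (T.guard (2 * b) - 1)

/-- On the right chain, the zones up to `b` end by guard `2 * b + 1`, and those from `J` on start
after guard `2 * J - 1`. -/
lemma not_high_of_low {J b : ℕ} (hb : b < J) (hJ : 2 * J < T.count) {s : Bool} {p : ℕ}
    (h : T.Low J s p) : ¬ T.High b s p := by
  cases s with
  | true =>
    have := guard_strictMono (T := T) (k := 2 * b) (m := 2 * J) (by omega) hJ.le (by omega)
    simp only [Low, High] at *
    omega
  | false =>
    have h1 := guard_mono (T := T) (k := 2 * b + 1) (m := 2 * J - 1) (by omega) (by omega)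
      (by omega)
    have h2 := hit_mono (T := T) (s := true) (i := T.guard (2 * b) - 1) (by omega)
      (guard_even_lt (T := T) (a := b) (by omega))
    rw [← guard_odd] at h2
    simp only [Low, High] at *
    omega

/-- For every pair of sufficiently distant zones, there is a point that sees only vertices between
them, and all the vertices that are between them and not in the first zone. -/
lemma exists_witness {a b : ℕ} (hab : a + 2 ≤ b) (hb : 2 * b < T.count) :
    ∃ z, T.Mem z ∧
      (∀ s p, p ≤ (T.c s).k → T.Sees z (T.vertex s p) → T.Low a s p ∧ T.High b s p) ∧
      ∀ a' b' s p, a < a' → 2 * a' < T.count → b' ≤ b → T.Low a' s p → T.High b' s p →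
        T.Sees z (T.vertex s p) := by
  have hg1 := guard_strictMono (T := T) (k := 2 * a) (m := 2 * (a + 1)) (by omega) (by omega)
    (by omega)
  have hg2 := guard_strictMono (T := T) (k := 2 * (a + 1)) (m := 2 * (a + 2)) (by omega) (by omega)
    (by omega)
  have hg3 := guard_mono (T := T) (k := 2 * (a + 2)) (m := 2 * b) (by omega) (by omega)
    (by omega)
  have hgb := guard_even_lt hb
  -- The witness is the crossing of the line of the edge leaving guard `2 * a` upwards and the line
  -- of the edge ending at guard `2 * b`. Two zones of distance make these edges distinct.
  have hij : T.guard (2 * a) < T.guard (2 * b) - 1 := by omega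
  have hj : T.guard (2 * b) - 1 < (T.c true).k := by omega
  have hj1 : T.guard (2 * b) - 1 + 1 = T.guard (2 * b) := by omega
  obtain ⟨z, h1, h2, hzi, hzj⟩ := exists_crossing hij hj
  refine ⟨z, mem_crossing hij hj h1 h2 hzi hzj, ?_, ?_⟩
  · rintro (_ | _) p hp hs
    · refine ⟨?_, ?_⟩
      · by_contra hc
        simp only [Low, not_or, not_lt] at hc
        obtain ⟨m, rfl⟩ : ∃ m, a = m + 1 := ⟨a - 1, by omega⟩
        exact not_sees_other_below_crossing (s := true) hij hj h1 hzi hc.2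
          (guard_odd_lt (a := m) (by omega)) (guard_even_succ m).symm hs
      · by_contra hc
        simp only [High, not_le] at hc
        exact not_sees_other_above_crossing (s := true) hj h2 hzj hc hp hs
    · refine ⟨?_, ?_⟩
      · by_contra hc
        simp only [Low, not_le] at hc
        exact not_sees_below_crossing hij hj h1 hzi hc hs
      · by_contra hc
        simp only [High, not_le] at hc
        exact not_sees_above_crossing h2 hzj (by omega) hp hs
  · rintro a' b' (_ | _) p ha ha' hb' hl hh
    · simp only [Low, High] at hl hh
      refine sees_other_crossing (s := true) hij hj hzi hzj ?_ ?_
      · have := guard_mono (T := T) (k := 2 * a + 1) (m := 2 * a' - 1) (by omega) (by omega)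
          (by omega)
        rw [← guard_odd]
        omega
      · have := guard_mono (T := T) (k := 2 * b') (m := 2 * b) (by omega) (by omega) (by omega)
        exact hh.trans (hit_mono (s := true) (by omega) hj)
    · simp only [Low, High] at hl hh
      have := guard_mono (T := T) (k := 2 * b') (m := 2 * b) (by omega) (by omega) (by omega)
      have := guard_mono (T := T) (k := 2 * a) (m := 2 * a') (by omega) (by omega) (by omega)
      exact sees_crossing hij hj h1 h2 hzi hzj (by omega) (by omega)

/-! ### Counting colors over intervals of zones. -/

section LowerBound

variable {ι : Type*} {G : Finset ι} {w : ι → Bool × ℕ} {col : ι → ℕ}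

/-- If `L k` is the largest possible `b - a` with `k` colors, the unique guard of the witness splits
the interval into two parts with one color fewer, losing zone `a` and the zone of the guard. This
gives `L (k + 1) ≤ 2 * L k + 3`, solved by the bound `4 * 2 ^ k - 3`. -/
lemma zones_le (hw : ∀ g ∈ G, (w g).2 ≤ (T.c (w g).1).k)
    (hcf : ∀ z, T.Mem z → ∃ g ∈ G, T.Sees z (T.vertex (w g).1 (w g).2) ∧
      ∀ g' ∈ G, T.Sees z (T.vertex (w g').1 (w g').2) → col g' = col g → g' = g)
    (k : ℕ) : ∀ (K : Finset ℕ) (a b : ℕ), K.card = k → 2 * b < T.count →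
      (∀ g ∈ G, T.Low a (w g).1 (w g).2 → T.High b (w g).1 (w g).2 → col g ∈ K) →
      b + 3 ≤ a + 4 * 2 ^ k := by
  classical
  induction k with
  | zero =>
    intro K a b hK hb hc
    by_contra! hlt
    obtain ⟨z, hz, hs, -⟩ := exists_witness (T := T) (a := a) (b := b) (by omega) hb
    obtain ⟨g, hg, hsg, -⟩ := hcf z hz
    have h1 := hs _ _ (hw g hg) hsg
    have := hc g hg h1.1 h1.2
    rw [Finset.card_eq_zero.1 hK] at this
    simp at this
  | succ k ih =>
    intro K a b hK hb hc
    have hpow : 1 ≤ 2 ^ k := Nat.one_le_two_pow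
    rw [pow_succ]
    rcases Nat.lt_or_ge b (a + 2) with hlt | hab
    · omega
    obtain ⟨z, hz, hs, hv⟩ := exists_witness hab hb
    obtain ⟨g, hg, hsg, hu⟩ := hcf z hz
    obtain ⟨hgl, hgh⟩ := hs _ _ (hw g hg) hsg
    have hKe : (K.erase (col g)).card = k := by
      rw [Finset.card_erase_of_mem (hc g hg hgl hgh)]; omega
    -- The zone of the unique guard `g` is the largest `J` with `T.Low J` at `g`, so `g` is in no
    -- interval that starts after `J` or ends before it.
    have hJl : T.Low (Nat.findGreatest (fun J => T.Low J (w g).1 (w g).2) b) (w g).1 (w g).2 :=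
      Nat.findGreatest_spec (P := fun J => T.Low J (w g).1 (w g).2) (by omega : a ≤ b) hgl
    have haJ := Nat.le_findGreatest (P := fun J => T.Low J (w g).1 (w g).2)
      (by omega : a ≤ b) hgl
    have hJb := Nat.findGreatest_le (P := fun J => T.Low J (w g).1 (w g).2) b
    have hJn : ∀ a', Nat.findGreatest (fun J => T.Low J (w g).1 (w g).2) b < a' → a' ≤ b →
        ¬ T.Low a' (w g).1 (w g).2 := 
      fun a' h1 h2 => Nat.findGreatest_is_greatest (P := fun J => T.Low J (w g).1 (w g).2) h1 h2
    generalize Nat.findGreatest (fun J => T.Low J (w g).1 (w g).2) b = J at *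
    have sub : ∀ a' b', a < a' → a' ≤ b → b' ≤ b → J < a' ∨ b' < J →
        b' + 3 ≤ a' + 4 * 2 ^ k := by
      intro a' b' h1 h2 h3 h4
      refine ih (K.erase (col g)) a' b' hKe (by omega) fun g' hg' hl' hh' => ?_
      have hs' := hv a' b' _ _ h1 (by omega) h3 hl' hh'
      obtain ⟨hl0, hh0⟩ := hs _ _ (hw g' hg') hs'
      refine Finset.mem_erase.2 ⟨fun he => ?_, hc g' hg' hl0 hh0⟩
      -- The witness sees every guard of the smaller interval, so one with the color of `g` would be
      -- `g`, which is outside.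
      rw [hu g' hg' hs' he] at hl' hh'
      rcases h4 with h4 | h4
      · exact hJn a' h4 h2 hl'
      · exact not_high_of_low h4 (by omega) hJl hh'
    have low : J + 2 ≤ a + 1 + 4 * 2 ^ k := by
      rcases Nat.lt_or_ge J 1 with h | h
      · omega
      · have := sub (a + 1) (J - 1) (by omega) (by omega) (by omega) (by omega)
        omega
    have high : b + 3 ≤ J + 1 + 4 * 2 ^ k := by
      rcases Nat.lt_or_ge J b with h | h
      · exact sub (J + 1) b (by omega) (by omega) le_rfl (by omega)
      · omega
    omega

/-- Few colors suffice only if there are few greedy guards. -/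
theorem count_le_of_conflictFree (hw : ∀ g ∈ G, (w g).2 ≤ (T.c (w g).1).k)
    (hcf : ∀ z, T.Mem z → ∃ g ∈ G, T.Sees z (T.vertex (w g).1 (w g).2) ∧
      ∀ g' ∈ G, T.Sees z (T.vertex (w g').1 (w g').2) → col g' = col g → g' = g) :
    T.count + 4 ≤ 8 * 2 ^ (G.image col).card := by
  have hpos := T.count_pos
  have := zones_le hw hcf _ (G.image col) 0 ((T.count - 1) / 2) rfl (by omega)
    fun g hg _ _ => Finset.mem_image_of_mem col hg
  omega

end LowerBound

end TwoChains

/-! ### The normal form of a funnel -/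

lemma slope_lt_of_turn {x₀ x₁ x₂ y₀ y₁ y₂ : ℝ} (h1 : y₀ < y₁) (h2 : y₁ < y₂)
    (h : 0 < (x₁ - x₀) * (y₂ - y₀) - (y₁ - y₀) * (x₂ - x₀)) :
    (x₂ - x₁) / (y₂ - y₁) < (x₁ - x₀) / (y₁ - y₀) := by
  rw [div_lt_div_iff₀ (by linarith) (by linarith)]
  linarith

namespace Funnel

variable (F : Funnel)

/-- The square of the length of the base. -/
def scale : ℝ :=
  ((F.v (F.n - 1)).1 - (F.v 0).1) ^ 2 + ((F.v (F.n - 1)).2 - (F.v 0).2) ^ 2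

/-- The coordinates of a point in the direction of the base and orthogonal to it. -/
def toNormal (p : ℝ × ℝ) : ℝ × ℝ :=
  (((F.v (F.n - 1)).1 - (F.v 0).1) * (p.1 - (F.v 0).1) +
    ((F.v (F.n - 1)).2 - (F.v 0).2) * (p.2 - (F.v 0).2), orient (F.v 0) (F.v (F.n - 1)) p)

/-- The inverse of `toNormal`. -/
noncomputable def ofNormal (q : ℝ × ℝ) : ℝ × ℝ :=
  ((F.v 0).1 + (((F.v (F.n - 1)).1 - (F.v 0).1) * q.1 -
      ((F.v (F.n - 1)).2 - (F.v 0).2) * q.2) / F.scale,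
    (F.v 0).2 + (((F.v (F.n - 1)).2 - (F.v 0).2) * q.1 +
      ((F.v (F.n - 1)).1 - (F.v 0).1) * q.2) / F.scale)

variable {F}

/-- With a degenerate base all heights would vanish, against `left_up`. -/
lemma scale_pos : 0 < F.scale := by
  have h := F.left_up 0 F.apex_pos
  by_contra! hc
  unfold scale at hc
  have h1 : (F.v (F.n - 1)).1 - (F.v 0).1 = 0 := by nlinarith
  have h2 : (F.v (F.n - 1)).2 - (F.v 0).2 = 0 := by nlinarith
  simp [orient, h1, h2] at h

lemma toNormal_ofNormal (q : ℝ × ℝ) : F.toNormal (F.ofNormal q) = q := by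
  have h := (F.scale_pos).ne'
  ext
  · simp only [toNormal, ofNormal]
    field_simp
    unfold scale
    ring
  · simp only [toNormal, ofNormal, orient]
    field_simp
    unfold scale
    ring

lemma ofNormal_toNormal (p : ℝ × ℝ) : F.ofNormal (F.toNormal p) = p := by
  have h := (F.scale_pos).ne'
  ext
  · simp only [toNormal, ofNormal, orient]
    field_simp
    unfold scale
    ring
  · simp only [toNormal, ofNormal, orient]
    field_simp
    unfold scale
    ring

lemma toNormal_injective : Function.Injective F.toNormal :=
  Function.LeftInverse.injective F.ofNormal_toNormal

lemma toNormal_add_smul (p d : ℝ × ℝ) (t : ℝ) :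
    F.toNormal (p + t • d) = F.toNormal p + t • (F.toNormal (p + d) - F.toNormal p) := by
  ext <;> simp [toNormal, orient] <;> ring

lemma continuous_toNormal : Continuous F.toNormal := by
  unfold toNormal orient; fun_prop

lemma continuous_ofNormal : Continuous F.ofNormal := by
  unfold ofNormal; fun_prop

lemma orient_toNormal (a b c : ℝ × ℝ) :
    orient (F.toNormal a) (F.toNormal b) (F.toNormal c) = F.scale * orient a b c := by
  simp only [orient, toNormal, scale]; ring

@[simp] lemma toNormal_first : F.toNormal (F.v 0) = (0, 0) := by
  simp [toNormal, orient]

lemma toNormal_last : F.toNormal (F.v (F.n - 1)) = (F.scale, 0) := by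
  ext <;> simp [toNormal, orient, scale] <;> ring

lemma continuous_coord (s : Bool) : Continuous (coord s) := by
  cases s
  · exact continuous_fst.neg
  · exact continuous_fst

lemma coord_add_smul (s : Bool) (p q : ℝ × ℝ) (t : ℝ) :
    coord s (p + t • (q - p)) = coord s p + t * (coord s q - coord s p) := by
  cases s <;> simp [coord]; ring

variable (F)

/-- The number of edges of the chain `s`. -/
def len (s : Bool) : ℕ := if s then F.apex else F.n - 1 - F.apex

/-- The index of the vertex `j` of the chain `s`, counted from the base. -/
def idx (s : Bool) (j : ℕ) : ℕ := if s then j else F.n - 1 - j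

/-- The vertex `j` of the chain `s` in normal coordinates. -/
def nv (s : Bool) (j : ℕ) : ℝ × ℝ := F.toNormal (F.v (F.idx s j))

variable {F}

lemma idx_len (s : Bool) : F.idx s (F.len s) = F.apex := by
  have := F.apex_lt
  cases s <;> simp [idx, len]; omega

lemma nv_lt_succ {s : Bool} {i : ℕ} (hi : i < F.len s) : (F.nv s i).2 < (F.nv s (i + 1)).2 := by
  have hn := F.apex_lt
  cases s with
  | true => exact F.left_up i (by simpa [len] using hi)
  | false =>
    simp only [len, Bool.false_eq_true, if_false] at hi
    have h := F.right_down (F.n - 1 - (i + 1)) (by omega) (by omega)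
    rw [show F.n - 1 - (i + 1) + 1 = F.n - 1 - i by omega] at h
    exact h

lemma nv_turn {s : Bool} {i : ℕ} (hi : i + 1 < F.len s) :
    0 < (coord s (F.nv s (i + 1)) - coord s (F.nv s i)) * ((F.nv s (i + 2)).2 - (F.nv s i).2) -
      ((F.nv s (i + 1)).2 - (F.nv s i).2) * (coord s (F.nv s (i + 2)) - coord s (F.nv s i)) := by
  have hn := F.apex_lt
  cases s with
  | true =>
    simp only [len, if_true] at hi
    have h := F.reflex i (by omega) (by omega)
    have h2 := orient_toNormal (F := F) (F.v i) (F.v (i + 1)) (F.v (i + 2))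
    have h3 := mul_pos F.scale_pos h
    rw [← h2] at h3
    simpa [orient, nv, idx, coord] using h3
  | false =>
    simp only [len, Bool.false_eq_true, if_false] at hi
    have h := F.reflex (F.n - 1 - (i + 2)) (by omega) (by omega)
    rw [show F.n - 1 - (i + 2) + 1 = F.n - 1 - (i + 1) by omega,
      show F.n - 1 - (i + 2) + 2 = F.n - 1 - i by omega] at h
    have h2 := orient_toNormal (F := F) (F.v (F.n - 1 - (i + 2))) (F.v (F.n - 1 - (i + 1)))
      (F.v (F.n - 1 - i))
    have h3 := mul_pos F.scale_pos h
    rw [← h2] at h3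
    simp only [orient, nv, idx, coord, Bool.false_eq_true, if_false] at h3 ⊢
    linarith

variable (F) in
/-- The chain `s` of a funnel in normal coordinates. -/
def chain (s : Bool) : ConcaveChain where
  k := F.len s
  x j := coord s (F.nv s j)
  y j := (F.nv s j).2
  k_pos := by
    have h1 := F.apex_pos
    have h2 := F.apex_lt
    cases s <;> simp [len] <;> omega
  y_zero := by
    cases s
    · simp [nv, idx, toNormal_last]
    · simp [nv, idx]
  y_lt_succ i hi := nv_lt_succ hi
  slope_lt i hi := slope_lt_of_turn (nv_lt_succ (by omega)) (nv_lt_succ hi) (nv_turn hi)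

lemma mem_edge_iff {s : Bool} {i : ℕ} (hi : i < F.len s) (q : ℝ × ℝ) :
    q ∈ segment ℝ (F.v (F.idx s i)) (F.v (F.idx s (i + 1))) ↔
      (F.chain s).y i ≤ (F.toNormal q).2 ∧ (F.toNormal q).2 ≤ (F.chain s).y (i + 1) ∧
        coord s (F.toNormal q) = (F.chain s).line i (F.toNormal q).2 := by
  have hlt : (F.nv s i).2 < (F.nv s (i + 1)).2 := nv_lt_succ hi
  have hpos : 0 < (F.nv s (i + 1)).2 - (F.nv s i).2 := by linarith
  have key : ∀ t : ℝ, F.toNormal (F.v (F.idx s i) + t • (F.v (F.idx s (i + 1)) - F.v (F.idx s i))) =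
      F.nv s i + t • (F.nv s (i + 1) - F.nv s i) := by
    intro t
    rw [toNormal_add_smul, add_sub_cancel]
    rfl
  simp only [ConcaveChain.line, ConcaveChain.slope]
  simp only [chain]
  rw [segment_eq_image']
  constructor
  · rintro ⟨t, ⟨h0, h1⟩, rfl⟩
    simp only [key, coord_add_smul]
    simp only [Prod.snd_add, Prod.smul_snd, Prod.snd_sub, smul_eq_mul]
    refine ⟨by nlinarith, by nlinarith, ?_⟩
    field_simp
    ring
  · rintro ⟨h1, h2, h3⟩
    refine ⟨((F.toNormal q).2 - (F.nv s i).2) / ((F.nv s (i + 1)).2 - (F.nv s i).2),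
      ⟨div_nonneg (by linarith) hpos.le, by rw [div_le_one hpos]; linarith⟩, ?_⟩
    apply toNormal_injective (F := F)
    simp only [key]
    have hc : ∀ p p' : ℝ × ℝ, coord s p = coord s p' → p.2 = p'.2 → p = p' := by
      intro p p' e1 e2
      refine Prod.ext ?_ e2
      cases s
      · simpa [coord] using e1
      · simpa [coord] using e1
    apply hc
    · rw [coord_add_smul, h3]
      field_simp
    · simp only [Prod.snd_add, Prod.smul_snd, Prod.snd_sub, smul_eq_mul]
      field_simp
      ring

lemma chain_top (s : Bool) : (F.chain s).y (F.chain s).k = (F.toNormal (F.v F.apex)).2 := by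
  simp only [chain, nv, idx_len]

lemma mem_chain_iff (s : Bool) (q : ℝ × ℝ) :
    (∃ i < F.len s, q ∈ segment ℝ (F.v (F.idx s i)) (F.v (F.idx s (i + 1)))) ↔
      0 ≤ (F.toNormal q).2 ∧ (F.toNormal q).2 ≤ (F.toNormal (F.v F.apex)).2 ∧
        coord s (F.toNormal q) = (F.chain s).f (F.toNormal q).2 := by
  rw [← chain_top s]
  constructor
  · rintro ⟨i, hi, hq⟩
    obtain ⟨h1, h2, h3⟩ := (mem_edge_iff hi q).1 hq
    have hk : i < (F.chain s).k := hi
    refine ⟨(ConcaveChain.y_nonneg hk.le).trans h1, h2.trans (ConcaveChain.y_le hk le_rfl), ?_⟩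
    rw [h3, ConcaveChain.f_eq_line hk h1 h2]
  · rintro ⟨h1, h2, h3⟩
    obtain ⟨e, he, h4, h5, h6⟩ := ConcaveChain.exists_edge h1 h2
    exact ⟨e, he, (mem_edge_iff he q).2 ⟨h4, h5, h3.trans h6⟩⟩

lemma mem_left_iff (q : ℝ × ℝ) : q ∈ polyChain F.v 0 F.apex ↔
    0 ≤ (F.toNormal q).2 ∧ (F.toNormal q).2 ≤ (F.toNormal (F.v F.apex)).2 ∧
      coord true (F.toNormal q) = (F.chain true).f (F.toNormal q).2 := by
  rw [← mem_chain_iff]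
  constructor
  · rintro ⟨i, -, h1, h2⟩
    exact ⟨i, h1, h2⟩
  · rintro ⟨i, h1, h2⟩
    exact ⟨i, Nat.zero_le _, h1, h2⟩

lemma mem_right_iff (q : ℝ × ℝ) : q ∈ polyChain F.v F.apex (F.n - 1) ↔
    0 ≤ (F.toNormal q).2 ∧ (F.toNormal q).2 ≤ (F.toNormal (F.v F.apex)).2 ∧
      coord false (F.toNormal q) = (F.chain false).f (F.toNormal q).2 := by
  rw [← mem_chain_iff]
  constructor
  · rintro ⟨i, h0, h1, h2⟩
    refine ⟨F.n - 1 - (i + 1), by simp only [len, Bool.false_eq_true, if_false]; omega, ?_⟩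
    simp only [idx, Bool.false_eq_true, if_false]
    rw [segment_symm, show F.n - 1 - (F.n - 1 - (i + 1)) = i + 1 by omega,
      show F.n - 1 - (F.n - 1 - (i + 1) + 1) = i by omega]
    exact h2
  · rintro ⟨i, h1, h2⟩
    simp only [len, Bool.false_eq_true, if_false] at h1
    simp only [idx, Bool.false_eq_true, if_false] at h2
    refine ⟨F.n - 1 - (i + 1), by omega, by omega, ?_⟩
    rw [segment_symm, show F.n - 1 - (i + 1) + 1 = F.n - 1 - i by omega]
    exact h2

/-- The chains are apart at the base. By the intermediate value theorem a violation would give a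
common point below the apex, contradicting simplicity. -/
lemma chain_apart {h : ℝ} (h0 : 0 ≤ h) (h1 : h < (F.toNormal (F.v F.apex)).2) :
    (F.chain true).f h + (F.chain false).f h < 0 := by
  by_contra! hc
  have hz : (F.chain true).f 0 + (F.chain false).f 0 ≤ 0 := by
    have e1 := ConcaveChain.f_y (c := F.chain true) (Nat.zero_le _)
    have e2 := ConcaveChain.f_y (c := F.chain false) (Nat.zero_le _)
    rw [ConcaveChain.y_zero] at e1 e2
    rw [e1, e2]
    simp only [chain, nv, idx, if_true, Bool.false_eq_true, if_false, Nat.sub_zero, toNormal_first,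
      toNormal_last, coord]
    linarith [F.scale_pos]
  obtain ⟨η, ⟨ha, hb⟩, hη⟩ := intermediate_value_Icc h0
    (f := fun h => (F.chain true).f h + (F.chain false).f h)
    (ConcaveChain.continuous_f.add ConcaveChain.continuous_f).continuousOn
    (show (0 : ℝ) ∈ Set.Icc _ _ from ⟨hz, hc⟩)
  have hη' : (F.chain true).f η + (F.chain false).f η = 0 := hη
  have hq := toNormal_ofNormal (F := F) ((F.chain true).f η, η)
  have hmem : F.ofNormal ((F.chain true).f η, η) ∈
      polyChain F.v 0 F.apex ∩ polyChain F.v F.apex (F.n - 1) := by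
    refine ⟨(mem_left_iff _).2 ?_, (mem_right_iff _).2 ?_⟩
    · rw [hq]
      exact ⟨ha, by simp only; linarith, by simp [coord]⟩
    · rw [hq]
      refine ⟨ha, by simp only; linarith, ?_⟩
      simp only [coord, Bool.false_eq_true, if_false]
      linarith
  rw [F.simple, Set.mem_singleton_iff] at hmem
  rw [hmem] at hq
  rw [hq] at h1
  simp only at h1
  linarith

variable (F) in
/-- The normal form of a funnel. -/
def twoChains : TwoChains where
  c := F.chain
  top := (F.toNormal (F.v F.apex)).2
  y_top := chain_top
  x_top s := by
    simp only [chain, nv, idx_len, coord_not]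
    ring
  apart s h h0 h1 := by
    cases s
    · rw [add_comm]; exact chain_apart h0 h1
    · exact chain_apart h0 h1

lemma vertex_twoChains (s : Bool) (j : ℕ) : F.twoChains.vertex s j = F.nv s j := by
  cases s <;> simp [TwoChains.vertex, twoChains, chain, coord]

/-! ### The polygonal region is the set between the chains. -/

lemma mem_boundary_iff (q : ℝ × ℝ) : q ∈ polyBoundary F.n F.v ↔
    (0 ≤ (F.toNormal q).2 ∧ (F.toNormal q).2 ≤ (F.toNormal (F.v F.apex)).2 ∧
      ∃ s, coord s (F.toNormal q) = (F.chain s).f (F.toNormal q).2) ∨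
    ((F.toNormal q).2 = 0 ∧ 0 ≤ (F.toNormal q).1 ∧ (F.toNormal q).1 ≤ F.scale) := by
  have hsplit : polyChain F.v 0 (F.n - 1) = polyChain F.v 0 F.apex ∪
      polyChain F.v F.apex (F.n - 1) := by
    have := F.apex_lt
    ext p
    constructor
    · rintro ⟨i, h1, h2, h3⟩
      rcases Nat.lt_or_ge i F.apex with h | h
      · exact Or.inl ⟨i, h1, h, h3⟩
      · exact Or.inr ⟨i, h, h2, h3⟩
    · rintro (⟨i, h1, h2, h3⟩ | ⟨i, h1, h2, h3⟩)
      · exact ⟨i, h1, by omega, h3⟩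
      · exact ⟨i, Nat.zero_le _, h2, h3⟩
  have hbase : q ∈ segment ℝ (F.v (F.n - 1)) (F.v 0) ↔
      (F.toNormal q).2 = 0 ∧ 0 ≤ (F.toNormal q).1 ∧ (F.toNormal q).1 ≤ F.scale := by
    have hpos := F.scale_pos
    rw [segment_symm, segment_eq_image']
    have key : ∀ t : ℝ, F.toNormal (F.v 0 + t • (F.v (F.n - 1) - F.v 0)) = (t * F.scale, 0) := by
      intro t
      rw [toNormal_add_smul, add_sub_cancel, toNormal_first, toNormal_last]
      simp
    constructor
    · rintro ⟨t, ⟨h0, h1⟩, rfl⟩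
      simp only [key]
      exact ⟨trivial, by positivity, by nlinarith⟩
    · rintro ⟨h0, h1, h2⟩
      refine ⟨(F.toNormal q).1 / F.scale, ⟨by positivity, by rw [div_le_one hpos]; exact h2⟩, ?_⟩
      apply toNormal_injective (F := F)
      simp only [key]
      rw [div_mul_cancel₀ _ hpos.ne']
      exact Prod.ext rfl h0.symm
  rw [polyBoundary, hsplit, Set.mem_union, Set.mem_union, mem_left_iff, mem_right_iff, hbase,
    Bool.exists_bool]
  tauto

lemma chain_f_zero (s : Bool) : (F.chain s).f 0 = if s then 0 else -F.scale := by
  have e1 := ConcaveChain.f_y (c := F.chain s) (Nat.zero_le _)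
  rw [ConcaveChain.y_zero] at e1
  rw [e1]
  cases s <;> simp [chain, nv, idx, coord, toNormal_last]

lemma mem_of_boundary {q : ℝ × ℝ} (h : q ∈ polyBoundary F.n F.v) :
    F.twoChains.Mem (F.toNormal q) := by
  rcases (mem_boundary_iff q).1 h with ⟨h0, h1, s, hs⟩ | ⟨h0, h1, h2⟩
  · refine ⟨h0, h1, fun s' => ?_⟩
    rcases Bool.eq_or_eq_not s' s with rfl | rfl
    · exact hs.ge
    · have := TwoChains.f_add_f_nonpos (T := F.twoChains) s h0 h1
      rw [coord_not, hs]
      simp only [twoChains] at *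
      linarith
  · refine ⟨h0.ge, ?_, fun s => ?_⟩
    · rw [h0, ← F.twoChains.y_top true]
      exact ConcaveChain.y_nonneg le_rfl
    · have := chain_f_zero (F := F) s
      simp only [twoChains]
      rw [h0, this]
      cases s <;> simp [coord] <;> linarith

lemma isBounded_normal {S : Set (ℝ × ℝ)} (h : ∀ p ∈ S, F.twoChains.Mem (F.toNormal p)) :
    Bornology.IsBounded S := by
  have hb : ∀ s, ∃ m, ∀ h ∈ Set.Icc 0 F.twoChains.top, m ≤ (F.chain s).f h := fun s => by
    have hc : IsCompact ((F.chain s).f '' Set.Icc 0 F.twoChains.top) :=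
      isCompact_Icc.image ConcaveChain.continuous_f
    obtain ⟨m, hm⟩ := hc.bddBelow
    exact ⟨m, fun h hh => hm ⟨h, hh, rfl⟩⟩
  obtain ⟨m₁, h₁⟩ := hb true
  obtain ⟨m₂, h₂⟩ := hb false
  have hc : IsCompact (F.ofNormal '' (Set.Icc m₁ (-m₂) ×ˢ Set.Icc 0 F.twoChains.top)) :=
    (isCompact_Icc.prod isCompact_Icc).image continuous_ofNormal
  refine hc.isBounded.subset ?_
  intro p hp
  obtain ⟨a, b, c⟩ := h p hp
  refine ⟨F.toNormal p, ⟨⟨?_, ?_⟩, a, b⟩, ofNormal_toNormal p⟩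
  · have := c true
    simp only [twoChains, coord, if_true] at this
    exact (h₁ _ ⟨a, b⟩).trans this
  · have := c false
    simp only [twoChains, coord, Bool.false_eq_true, if_false] at this
    linarith [h₂ _ ⟨a, b⟩]

/-- A ray that avoids the closed region shows that its points are not enclosed. -/
lemma not_isBounded_of_ray {p d : ℝ × ℝ} (hd : d ≠ 0)
    (h : ∀ t : ℝ, 0 ≤ t → ¬ F.twoChains.Mem (F.toNormal (p + t • d))) :
    ¬ Bornology.IsBounded (connectedComponentIn (polyBoundary F.n F.v)ᶜ p) := by
  intro hb
  have hconn : IsPreconnected ((fun t : ℝ => p + t • d) '' Set.Ici 0) :=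
    isPreconnected_Ici.image _ (by fun_prop)
  have hsub : (fun t : ℝ => p + t • d) '' Set.Ici 0 ⊆
      connectedComponentIn (polyBoundary F.n F.v)ᶜ p := by
    refine hconn.subset_connectedComponentIn ⟨0, Set.self_mem_Ici, by simp⟩ ?_
    rintro _ ⟨t, ht, rfl⟩ hq
    exact h t ht (mem_of_boundary hq)
  obtain ⟨C, hC⟩ := (hb.subset hsub).exists_norm_le
  have hdn : 0 < ‖d‖ := norm_pos_iff.2 hd
  have hC0 : 0 ≤ C := (norm_nonneg _).trans (hC _ ⟨0, Set.self_mem_Ici, rfl⟩)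
  have h1 := hC _ ⟨(C + ‖p‖ + 1) / ‖d‖, Set.mem_Ici.2 (by positivity), rfl⟩
  have h2 : ‖((C + ‖p‖ + 1) / ‖d‖) • d‖ = C + ‖p‖ + 1 := by
    rw [norm_smul, Real.norm_of_nonneg (by positivity), div_mul_cancel₀ _ hdn.ne']
  have h3 := norm_sub_le (p + ((C + ‖p‖ + 1) / ‖d‖) • d) p
  rw [add_sub_cancel_left, h2] at h3
  simp only at h1
  linarith

lemma isClosed_mem : IsClosed {p | F.twoChains.Mem (F.toNormal p)} := by
  have hc := continuous_toNormal (F := F)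
  have h1 : Continuous fun p => (F.toNormal p).2 := hc.snd
  have h2 : ∀ s, Continuous fun p => coord s (F.toNormal p) :=
    fun s => (continuous_coord s).comp hc
  simp only [TwoChains.Mem, Set.ofPred_and, Set.ofPred_forall]
  refine (isClosed_le continuous_const h1).inter ((isClosed_le h1 continuous_const).inter
    (isClosed_iInter fun s => isClosed_le ?_ (h2 s)))
  exact ConcaveChain.continuous_f.comp h1

lemma mem_region_of_mem {p : ℝ × ℝ} (hp : F.twoChains.Mem (F.toNormal p)) : p ∈ F.region := by
  by_cases hpb : p ∈ polyBoundary F.n F.v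
  · exact Or.inl hpb
  refine Or.inr ?_
  have hc := continuous_toNormal (F := F)
  have h1 : Continuous fun p => (F.toNormal p).2 := hc.snd
  have h2 : ∀ s, Continuous fun p => coord s (F.toNormal p) :=
    fun s => (continuous_coord s).comp hc
  let U : Set (ℝ × ℝ) := {q | 0 < (F.toNormal q).2 ∧ (F.toNormal q).2 < F.twoChains.top ∧
    ∀ s, (F.chain s).f (F.toNormal q).2 < coord s (F.toNormal q)}
  have hU : IsOpen U := by
    simp only [U, Set.ofPred_and, Set.ofPred_forall]
    refine (isOpen_lt continuous_const h1).inter ((isOpen_lt h1 continuous_const).inter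
      (isOpen_iInter_of_finite fun s => isOpen_lt ?_ (h2 s)))
    exact ConcaveChain.continuous_f.comp h1
  have hsplit : ∀ q, q ∉ polyBoundary F.n F.v → F.twoChains.Mem (F.toNormal q) → q ∈ U := by
    intro q hqb ⟨a, b, c⟩
    rw [mem_boundary_iff] at hqb
    push Not at hqb
    have hs : ∀ s, (F.chain s).f (F.toNormal q).2 < coord s (F.toNormal q) :=
      fun s => lt_of_le_of_ne (c s) (Ne.symm (hqb.1 a b s))
    refine ⟨lt_of_le_of_ne a fun h0 => ?_, lt_of_le_of_ne b fun ht => ?_, hs⟩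
    · have e1 := c true
      have e2 := c false
      simp only [twoChains] at e1 e2
      rw [← h0, chain_f_zero] at e1 e2
      simp only [coord, if_true, Bool.false_eq_true, if_false] at e1 e2
      have := hqb.2 h0.symm e1
      linarith
    · have e1 := hs true
      have e2 := hs false
      have e3 := F.twoChains.x_top true
      have e4 := ConcaveChain.f_y (c := F.chain true) le_rfl
      have e5 := ConcaveChain.f_y (c := F.chain false) le_rfl
      rw [chain_top] at e4 e5
      simp only [twoChains, Bool.not_true] at ht e3
      rw [ht] at e1 e2
      simp only [coord, if_true, Bool.false_eq_true, if_false] at e1 e2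
      linarith
  -- Off the boundary, the open interior `U` and the open complement of the closed set between the
  -- chains cover everything, so a component that meets `U` stays in it.
  have hsub : connectedComponentIn (polyBoundary F.n F.v)ᶜ p ⊆ U := by
    refine isPreconnected_connectedComponentIn.subset_left_of_subset_union hU
      (isClosed_mem (F := F)).isOpen_compl ?_ ?_ ⟨p, mem_connectedComponentIn hpb, hsplit p hpb hp⟩
    · rw [Set.disjoint_compl_right_iff_subset]
      exact fun q hq => ⟨hq.1.le, hq.2.1.le, fun s => (hq.2.2 s).le⟩
    · intro q hq
      by_cases hm : F.twoChains.Mem (F.toNormal q)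
      · exact Or.inl (hsplit q (connectedComponentIn_subset _ _ hq) hm)
      · exact Or.inr hm
  exact isBounded_normal fun q hq =>
    ⟨(hsub hq).1.le, (hsub hq).2.1.le, fun s => ((hsub hq).2.2 s).le⟩

lemma mem_of_mem_region {p : ℝ × ℝ} (hp : p ∈ F.region) : F.twoChains.Mem (F.toNormal p) := by
  rcases hp with hp | hp
  · exact mem_of_boundary hp
  by_contra hm
  have hpos := F.scale_pos
  have key : ∀ t : ℝ, F.toNormal (p + t • (F.v (F.n - 1) - F.v 0)) =
      F.toNormal p + (t * F.scale, 0) := by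
    intro t
    ext <;> simp [toNormal, orient, scale] <;> ring
  have hd : F.v (F.n - 1) - F.v 0 ≠ 0 := by
    intro h
    have := key 1
    rw [h] at this
    have := congrArg Prod.fst this
    simp at this
    exact hpos.ne' this
  -- Horizontal slices of the set between the chains are convex. An outside point therefore has a
  -- horizontal ray, to the right or to the left, that avoids the set.
  by_cases hr : ∀ t : ℝ, 0 ≤ t → ¬ F.twoChains.Mem (F.toNormal (p + t • (F.v (F.n - 1) - F.v 0)))
  · exact not_isBounded_of_ray hd hr hp
  by_cases hl : ∀ t : ℝ, 0 ≤ t →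
      ¬ F.twoChains.Mem (F.toNormal (p + t • (-(F.v (F.n - 1) - F.v 0))))
  · exact not_isBounded_of_ray (neg_ne_zero.2 hd) hl hp
  push Not at hr hl
  obtain ⟨t, ht, a, b, c⟩ := hr
  obtain ⟨u, hu, a', b', c'⟩ := hl
  rw [smul_neg, ← neg_smul, key] at a' b' c'
  rw [key] at a b c
  simp only [Prod.snd_add, add_zero] at a b c a' b' c'
  refine hm ⟨a, b, fun s => ?_⟩
  have h1 := mul_nonneg ht hpos.le
  have h2 := mul_nonneg hu hpos.le
  cases s with
  | true =>
    have := c' true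
    simp only [coord, if_true, Prod.fst_add] at this ⊢
    linarith
  | false =>
    have := c false
    simp only [coord, Bool.false_eq_true, if_false, Prod.fst_add] at this ⊢
    linarith

lemma mem_region_iff {p : ℝ × ℝ} : p ∈ F.region ↔ F.twoChains.Mem (F.toNormal p) :=
  ⟨mem_of_mem_region, mem_region_of_mem⟩

lemma sees_iff {p q : ℝ × ℝ} (hp : p ∈ F.region) (hq : q ∈ F.region) :
    F.Sees p q ↔ F.twoChains.Sees (F.toNormal p) (F.toNormal q) := by
  have key : ∀ t : ℝ, F.toNormal (p + t • (q - p)) =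
      F.toNormal p + t • (F.toNormal q - F.toNormal p) := by
    intro t
    rw [toNormal_add_smul, add_sub_cancel]
  have hP := mem_region_iff.1 hp
  have hQ := mem_region_iff.1 hq
  unfold Sees
  rw [segment_eq_image']
  constructor
  · intro h s t h0 h1
    have := (mem_region_iff.1 (h ⟨t, ⟨h0, h1⟩, rfl⟩)).2.2 s
    simp only [key, coord_add_smul] at this
    simpa using this
  · rintro h _ ⟨t, ⟨h0, h1⟩, rfl⟩
    rw [mem_region_iff]
    simp only [key]
    refine ⟨?_, ?_, fun s => ?_⟩
    · simp only [Prod.snd_add, Prod.smul_snd, Prod.snd_sub, smul_eq_mul]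
      nlinarith [hP.1, hQ.1]
    · simp only [Prod.snd_add, Prod.smul_snd, Prod.snd_sub, smul_eq_mul]
      nlinarith [hP.2.1, hQ.2.1]
    · rw [coord_add_smul]
      simpa using h s t h0 h1

lemma vertex_mem_region {i : ℕ} (hi : i < F.n) : F.v i ∈ F.region := by
  have := F.apex_lt
  refine Or.inl ?_
  rcases Nat.lt_or_ge i (F.n - 1) with h | h
  · exact Or.inl ⟨i, Nat.zero_le _, h, left_mem_segment _ _ _⟩
  · rw [show i = F.n - 1 by omega]
    exact Or.inr (left_mem_segment _ _ _)

end Funnel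

/-! ### The algorithm -/

namespace RAM

lemma Mem.store_same (σ : Mem) (a i k : ℕ) : σ.store a i k a i = k := by
  simp [Mem.store]

lemma Mem.store_array_ne (σ : Mem) {a b : ℕ} (i k : ℕ) (h : b ≠ a) : σ.store a i k b = σ b := by
  simp [Mem.store, h]

lemma Mem.store_store (σ : Mem) (a i k l : ℕ) : (σ.store a i k).store a i l = σ.store a i l := by
  simp [Mem.store]

/-- A loop with an invariant that determines the number of its iterations. -/
lemma exec_while {pt : ℕ → ℝ × ℝ} {b : BExp} {P : Prog} {c : ℕ} (N : ℕ) {I : ℕ → Mem → Prop}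
    (step : ∀ i < N, ∀ σ, I i σ → b.Holds pt σ ∧ ∃ τ t, Exec pt P σ τ t ∧ t ≤ c ∧ I (i + 1) τ)
    (hfin : ∀ σ, I N σ → ¬ b.Holds pt σ) {σ : Mem} (h : I 0 σ) :
    ∃ τ t, Exec pt (.while b P) σ τ t ∧ t ≤ N * (b.cost + c + 1) + b.cost + 1 ∧ I N τ := by
  induction N generalizing I σ with
  | zero => exact ⟨σ, _, .whileFalse (hfin σ h), by omega, h⟩
  | succ N ih =>
    obtain ⟨hb, τ, t, h1, h2, h3⟩ := step 0 (by omega) σ h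
    obtain ⟨υ, u, h4, h5, h6⟩ := ih (I := fun i => I (i + 1))
      (fun i hi => step (i + 1) (by omega)) hfin h3
    refine ⟨υ, _, .whileTrue hb h1 h4, ?_, h6⟩
    rw [Nat.succ_mul]
    omega

/-- The number of vertices. -/
def nE : NExp := .get 0 (.lit 0)

/-- The index of the apex. -/
def apexE : NExp := .get 0 (.lit 1)

/-- The counter of the loop that computes the colors. -/
def fillE : NExp := .get 3 (.lit 0)

/-- The number of guards that have been placed. -/
def countE : NExp := .get 4 (.lit 0)

/-- The index of the current guard. -/
def curE : NExp := .get 5 (.lit 0)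

/-- The index of the candidate for the next guard. -/
def nextE : NExp := .get 6 (.lit 0)

/-- The orientation of three input points. -/
def orientE (a b c : NExp) : RExp :=
  .sub (.mul (.sub (.x b) (.x a)) (.sub (.y c) (.y a)))
    (.mul (.sub (.y b) (.y a)) (.sub (.x c) (.x a)))

/-- Four times the counter `fillE`, plus `c`. -/
def fourE (c : ℕ) : NExp := .add (.add (.add fillE fillE) (.add fillE fillE)) (.lit c)

/-- Computes four consecutive entries of the ruler coloring. -/
def fillBody : Prog :=
  .seq (.set 2 (fourE 0) (.lit 1)) <|
  .seq (.set 2 (fourE 1) (.lit 3)) <|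
  .seq (.set 2 (fourE 2) (.lit 2)) <|
  .seq (.set 2 (fourE 3) (.add (.get 2 (.add (.add fillE fillE) (.lit 1))) (.lit 1)))
    (.set 3 (.lit 0) (.add fillE (.lit 1)))

/-- Stores the ruler coloring in array `2`. -/
def fill : Prog := .while (.nlt fillE nE) fillBody

/-- The candidate can be moved up on the right chain. -/
def rightTest : BExp :=
  .and (.nlt apexE nextE)
    (.not (.rlt (.lit 0) (orientE curE (.add curE (.lit 1)) (.sub nextE (.lit 1)))))

/-- Finds the last vertex of the right chain below the extension of an edge of the left chain. -/
def searchRight : Prog :=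
  .seq (.set 6 (.lit 0) (.sub nE (.lit 1)))
    (.while rightTest (.set 6 (.lit 0) (.sub nextE (.lit 1))))

/-- The candidate can be moved up on the left chain. -/
def leftTest : BExp :=
  .and (.nlt nextE apexE)
    (.not (.rlt (orientE curE (.sub curE (.lit 1)) (.add nextE (.lit 1))) (.lit 0)))

/-- Finds the last vertex of the left chain below the extension of an edge of the right chain. -/
def searchLeft : Prog :=
  .seq (.set 6 (.lit 0) (.lit 0)) (.while leftTest (.set 6 (.lit 0) (.add nextE (.lit 1))))

/-- Places a guard and finds the next one. -/
def guardBody : Prog :=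
  .seq (.set 1 curE (.get 2 countE)) <|
  .seq (.set 4 (.lit 0) (.add countE (.lit 1))) <|
  .seq (.ite (.nlt curE apexE) searchRight searchLeft) (.set 5 (.lit 0) nextE)

/-- The current guard is not the apex. -/
def guardTest : BExp := .not (.and (.not (.nlt curE apexE)) (.not (.nlt apexE curE)))

/-- The algorithm: color the greedy guards by the ruler coloring. -/
def greedy : Prog := .seq fill (.while guardTest guardBody)

/-! ### Correctness of the color table. -/

lemma exec_fillBody {pt : ℕ → ℝ × ℝ} {σ : Mem} {q : ℕ} (hq : σ 3 0 = q)
    (hC : ∀ i < 4 * q, σ 2 i = rulerColor i) :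
    ∃ τ t, Exec pt fillBody σ τ t ∧ t ≤ 100 ∧ τ 3 0 = q + 1 ∧
      (∀ i < 4 * (q + 1), τ 2 i = rulerColor i) ∧
      ∀ a, a ≠ 2 → a ≠ 3 → τ a = σ a := by
  have e1 : q + q + (q + q) = 4 * q := by ring
  refine ⟨_, _, .seq (.set _ _ _ _) (.seq (.set _ _ _ _) (.seq (.set _ _ _ _)
    (.seq (.set _ _ _ _) (.set _ _ _ _)))), ?_, ?_, ?_, ?_⟩
  · simp [NExp.cost, fourE, fillE]
  · simp [NExp.eval, fourE, fillE, Mem.store, hq]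
  · intro i hi
    simp only [NExp.eval, fourE, fillE, Mem.store, hq, e1, Function.update_apply,
      Nat.reduceEqDiff, if_true, if_false]
    have e4 := rulerColor_three q
    have e3 := rulerColor_two q
    have e2 := rulerColor_one q
    have e0 := rulerColor_zero q
    rcases Nat.lt_or_ge i (4 * q) with h | h
    · rw [if_neg (by omega), if_neg (by omega), if_neg (by omega), if_neg (by omega), hC i h]
    · obtain rfl | rfl | rfl | rfl : i = 4 * q ∨ i = 4 * q + 1 ∨ i = 4 * q + 2 ∨
        i = 4 * q + 3 := by omega
      · rw [if_neg (by omega), if_neg (by omega), if_neg (by omega), if_pos (by omega), e0]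
      · rw [if_neg (by omega), if_neg (by omega), if_pos (by omega), e2]
      · rw [if_neg (by omega), if_pos (by omega), e3]
      · rw [if_pos (by omega), e4]
        -- In the first round, entry 3 depends on entry 1 written in the same round; later rounds
        -- read entries of earlier ones.
        rcases Nat.eq_zero_or_pos q with rfl | h0
        · simpa using rulerColor_one 0
        · rw [if_neg (by omega), if_neg (by omega), if_neg (by omega), hC _ (by omega), two_mul]
  · intro a h2 h3
    simp [Mem.store, h2, h3]

lemma exec_fill {pt : ℕ → ℝ × ℝ} {σ : Mem} (hσ : σ 3 0 = 0) :
    ∃ τ t, Exec pt fill σ τ t ∧ t ≤ σ 0 0 * 106 + 6 ∧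
      (∀ i < 4 * σ 0 0, τ 2 i = rulerColor i) ∧ ∀ a, a ≠ 2 → a ≠ 3 → τ a = σ a := by
  obtain ⟨τ, t, h1, h2, -, h4, h5⟩ := exec_while (pt := pt) (b := .nlt fillE nE) (P := fillBody)
    (c := 100) (σ 0 0)
    (I := fun q τ => τ 3 0 = q ∧ (∀ i < 4 * q, τ 2 i = rulerColor i) ∧
      ∀ a, a ≠ 2 → a ≠ 3 → τ a = σ a)
    (by
      rintro q hq τ ⟨h1, h2, h3⟩
      refine ⟨by simpa [BExp.Holds, NExp.eval, fillE, nE, h1, h3] using hq, ?_⟩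
      obtain ⟨υ, t, g1, g2, g3, g4, g5⟩ := exec_fillBody (pt := pt) h1 h2
      exact ⟨υ, t, g1, g2, g3, g4, fun a ha hb => (g5 a ha hb).trans (h3 a ha hb)⟩)
    (by
      rintro τ ⟨h1, h2, h3⟩
      simp [BExp.Holds, NExp.eval, fillE, nE, h1, h3])
    (σ := σ) ⟨hσ, by simp, fun _ _ _ => rfl⟩
  exact ⟨τ, t, h1, h2, h4, h5⟩

end RAM

namespace Funnel

open RAM

variable {F : Funnel}

/-! ### Orientation tests and the search for the next guard. -/

/-- Multiplying by the positive height of the edge removes the division, so that the machine can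
test the condition by a polynomial. -/
lemma under_iff_turn {s : Bool} {i j : ℕ} (hi : i < F.len s) :
    F.twoChains.Under s i j ↔
      (coord s (F.nv s (i + 1)) - coord s (F.nv s i)) * ((F.nv (!s) j).2 - (F.nv s i).2) ≤
        ((F.nv s (i + 1)).2 - (F.nv s i).2) * (coord s (F.nv (!s) j) - coord s (F.nv s i)) := by
  have hpos : 0 < (F.nv s (i + 1)).2 - (F.nv s i).2 := sub_pos.2 (nv_lt_succ hi)
  have h : coord (!s) (F.nv (!s) j) = -coord s (F.nv (!s) j) := coord_not _ _
  simp only [TwoChains.Under, ConcaveChain.line, ConcaveChain.slope]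
  simp only [twoChains, chain, h]
  rw [show -coord s (F.nv (!s) j) + (coord s (F.nv s i) + (coord s (F.nv s (i + 1)) -
    coord s (F.nv s i)) / ((F.nv s (i + 1)).2 - (F.nv s i).2) * ((F.nv (!s) j).2 - (F.nv s i).2)) =
    ((coord s (F.nv s (i + 1)) - coord s (F.nv s i)) * ((F.nv (!s) j).2 - (F.nv s i).2) -
      ((F.nv s (i + 1)).2 - (F.nv s i).2) * (coord s (F.nv (!s) j) - coord s (F.nv s i))) /
      ((F.nv s (i + 1)).2 - (F.nv s i).2) by field_simp; ring, div_nonpos_iff]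
  constructor
  · rintro (h | h)
    · linarith [h.2]
    · linarith [h.1]
  · intro h
    exact Or.inr ⟨by linarith, hpos.le⟩

lemma under_true_iff {i j : ℕ} (hi : i < F.apex) :
    F.twoChains.Under true i j ↔ ¬ 0 < orient (F.v i) (F.v (i + 1)) (F.v (F.n - 1 - j)) := by
  rw [under_iff_turn (by simpa [len] using hi), ← mul_pos_iff_of_pos_left F.scale_pos,
    ← orient_toNormal, not_lt]
  simp only [orient, nv, idx, coord, if_true, Bool.not_true, Bool.false_eq_true, if_false]
  exact sub_nonpos.symm

lemma under_false_iff {i j : ℕ} (hi : i < F.n - 1 - F.apex) :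
    F.twoChains.Under false i j ↔
      ¬ orient (F.v (F.n - 1 - i)) (F.v (F.n - 1 - i - 1)) (F.v j) < 0 := by
  rw [under_iff_turn (by simpa [len] using hi), not_lt, ← mul_nonneg_iff_of_pos_left F.scale_pos,
    ← orient_toNormal]
  simp only [orient, nv, idx, coord, if_true, Bool.not_false, Bool.false_eq_true, if_false,
    Nat.sub_sub, Nat.add_assoc]
  constructor <;> intro h <;> linarith

lemma exec_searchRight {σ : Mem} (h0 : σ 0 0 = F.n) (h1 : σ 0 1 = F.apex) {i : ℕ}
    (hi : i < F.apex) (hc : σ 5 0 = i) :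
    ∃ t, Exec F.inputPoints searchRight σ (σ.store 6 0 (F.idx false (F.twoChains.hit true i))) t ∧
      t ≤ 100 * (F.n + 1) := by
  have hn := F.apex_lt
  have hle : F.twoChains.hit true i ≤ F.n - 1 - F.apex := TwoChains.hit_le (T := F.twoChains) true i
  -- The vertices within reach form an initial part of the chain, so the linear search stops exactly
  -- at `hit`.
  have htest : ∀ j ≤ F.n - 1 - F.apex,
      (rightTest.Holds F.inputPoints (σ.store 6 0 (F.n - 1 - j)) ↔ j < F.twoChains.hit true i) := by
    intro j hj
    have hold : rightTest.Holds F.inputPoints (σ.store 6 0 (F.n - 1 - j)) ↔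
        F.apex < F.n - 1 - j ∧ ¬ 0 < orient (F.inputPoints i) (F.inputPoints (i + 1))
          (F.inputPoints (F.n - 1 - j - 1)) := by
      simp [rightTest, BExp.Holds, NExp.eval, RExp.eval, orientE, apexE, nextE, curE, Mem.store,
        h1, hc, orient]
    rw [hold]
    simp only [inputPoints]
    rw [if_pos (by omega), if_pos (by omega), if_pos (by omega), Nat.sub_sub _ j 1,
      ← under_true_iff hi]
    constructor
    · rintro ⟨h2, h3⟩
      have hj' : j + 1 ≤ (F.twoChains.c !true).k := by
        show j + 1 ≤ F.n - 1 - F.apex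
        omega
      have := (TwoChains.under_iff (T := F.twoChains) (s := true) hi hj').1 h3
      omega
    · intro h2
      have hj' : j + 1 ≤ (F.twoChains.c !true).k := by
        show j + 1 ≤ F.n - 1 - F.apex
        omega
      exact ⟨by omega, (TwoChains.under_iff (T := F.twoChains) (s := true) hi hj').2 h2⟩
  obtain ⟨τ, t, e1, e2, rfl⟩ := exec_while (pt := F.inputPoints) (b := rightTest)
    (P := .set 6 (.lit 0) (.sub nextE (.lit 1))) (c := 6) (F.twoChains.hit true i)
    (I := fun j τ => τ = σ.store 6 0 (F.n - 1 - j))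
    (by
      rintro j hj τ rfl
      refine ⟨(htest j (by omega)).2 hj, _, _, .set _ _ _ _, by simp [NExp.cost, nextE], ?_⟩
      simp only [NExp.eval, nextE, Mem.store_same, Mem.store_store, Nat.sub_sub, Nat.add_assoc])
    (by
      rintro τ rfl
      rw [htest _ hle]
      omega)
    (σ := σ.store 6 0 (F.n - 1 - 0)) rfl
  have hset := Exec.set (pt := F.inputPoints) 6 (.lit 0) (.sub nE (.lit 1)) σ
  simp only [NExp.eval, nE, h0] at hset
  refine ⟨_, .seq hset e1, ?_⟩
  have hcost : rightTest.cost = 48 := rfl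
  rw [hcost] at e2
  simp only [NExp.cost]
  omega

lemma exec_searchLeft {σ : Mem} (h1 : σ 0 1 = F.apex) {i : ℕ}
    (hi : i < F.n - 1 - F.apex) (hc : σ 5 0 = F.n - 1 - i) :
    ∃ t, Exec F.inputPoints searchLeft σ (σ.store 6 0 (F.idx true (F.twoChains.hit false i))) t ∧
      t ≤ 100 * (F.n + 1) := by
  have hn := F.apex_lt
  have hle : F.twoChains.hit false i ≤ F.apex := TwoChains.hit_le (T := F.twoChains) false i
  have htest : ∀ j ≤ F.apex,
      (leftTest.Holds F.inputPoints (σ.store 6 0 j) ↔ j < F.twoChains.hit false i) := by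
    intro j hj
    have hold : leftTest.Holds F.inputPoints (σ.store 6 0 j) ↔
        j < F.apex ∧ ¬ orient (F.inputPoints (F.n - 1 - i)) (F.inputPoints (F.n - 1 - i - 1))
          (F.inputPoints (j + 1)) < 0 := by
      simp [leftTest, BExp.Holds, NExp.eval, RExp.eval, orientE, apexE, nextE, curE, Mem.store,
        h1, hc, orient]
    rw [hold]
    simp only [inputPoints]
    rw [if_pos (by omega), if_pos (by omega), if_pos (by omega), ← under_false_iff hi]
    constructor
    · rintro ⟨h2, h3⟩
      have := (TwoChains.under_iff (T := F.twoChains) (s := false) hi h2).1 h3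
      omega
    · intro h2
      have hj' : j + 1 ≤ F.apex := by omega
      exact ⟨by omega, (TwoChains.under_iff (T := F.twoChains) (s := false) hi hj').2 h2⟩
  obtain ⟨τ, t, e1, e2, rfl⟩ := exec_while (pt := F.inputPoints) (b := leftTest)
    (P := .set 6 (.lit 0) (.add nextE (.lit 1))) (c := 6) (F.twoChains.hit false i)
    (I := fun j τ => τ = σ.store 6 0 j)
    (by
      rintro j hj τ rfl
      refine ⟨(htest j (by omega)).2 hj, _, _, .set _ _ _ _, by simp [NExp.cost, nextE], ?_⟩
      simp only [NExp.eval, nextE, Mem.store_same, Mem.store_store])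
    (by
      rintro τ rfl
      rw [htest _ hle]
      omega)
    (σ := σ.store 6 0 0) rfl
  have hset := Exec.set (pt := F.inputPoints) 6 (.lit 0) (.lit 0) σ
  simp only [NExp.eval] at hset
  refine ⟨_, .seq hset e1, ?_⟩
  have hcost : leftTest.cost = 48 := rfl
  rw [hcost] at e2
  simp only [NExp.cost]
  omega

variable (F) in
/-- The index of the guard number `k`. -/
noncomputable def guardIdx (k : ℕ) : ℕ := F.idx (side k) (F.twoChains.guard k)

lemma guardIdx_cases {k : ℕ} (hk : k < F.twoChains.count) :
    (side k = true ∧ F.guardIdx k = F.twoChains.guard k ∧ F.twoChains.guard k < F.apex) ∨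
    (side k = false ∧ F.guardIdx k = F.n - 1 - F.twoChains.guard k ∧
      F.twoChains.guard k < F.n - 1 - F.apex) := by
  have h := TwoChains.guard_lt hk
  unfold guardIdx
  cases hs : side k with
  | true =>
    rw [hs] at h
    exact Or.inl ⟨rfl, rfl, h⟩
  | false =>
    rw [hs] at h
    exact Or.inr ⟨rfl, rfl, h⟩

lemma guardIdx_lt {k : ℕ} (hk : k < F.twoChains.count) : F.guardIdx k < F.n := by
  have := F.apex_lt
  rcases guardIdx_cases hk with ⟨-, h1, h2⟩ | ⟨-, h1, h2⟩ <;> omega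

lemma guardIdx_ne_apex {k : ℕ} (hk : k < F.twoChains.count) : F.guardIdx k ≠ F.apex := by
  rcases guardIdx_cases hk with ⟨-, h1, h2⟩ | ⟨-, h1, h2⟩ <;> omega

lemma guardIdx_count : F.guardIdx F.twoChains.count = F.apex := by
  rw [guardIdx, TwoChains.guard_count]
  exact idx_len _

/-- Guards on one chain are strictly increasing, and guards on different chains have indices on
different sides of the apex. -/
lemma guardIdx_injective {k m : ℕ} (hk : k < F.twoChains.count) (hm : m < F.twoChains.count)
    (h : F.guardIdx k = F.guardIdx m) : k = m := by
  by_contra hne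
  wlog hlt : k < m generalizing k m
  · exact this hm hk h.symm (Ne.symm hne) (by omega)
  by_cases hp : k % 2 = m % 2
  · have h1 := TwoChains.guard_strictMono (T := F.twoChains) hlt hm.le hp
    have h2 : side k = side m := by rw [side_eq, side_eq, decide_eq_decide]; omega
    rcases guardIdx_cases hk with ⟨a1, a2, a3⟩ | ⟨a1, a2, a3⟩ <;>
      rcases guardIdx_cases hm with ⟨b1, b2, b3⟩ | ⟨b1, b2, b3⟩
    · omega
    · simp [a1, b1] at h2
    · simp [a1, b1] at h2
    · omega
  · have h2 : side k ≠ side m := by rw [side_eq, side_eq, Ne, decide_eq_decide]; omega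
    rcases guardIdx_cases hk with ⟨a1, a2, a3⟩ | ⟨a1, a2, a3⟩ <;>
      rcases guardIdx_cases hm with ⟨b1, b2, b3⟩ | ⟨b1, b2, b3⟩
    · simp [a1, b1] at h2
    · omega
    · omega
    · simp [a1, b1] at h2

variable (F) in
/-- The memory after `m` guards have been placed. -/
def Placed (m : ℕ) (σ : Mem) : Prop :=
  σ 0 0 = F.n ∧ σ 0 1 = F.apex ∧ (∀ i < 4 * F.n, σ 2 i = rulerColor i) ∧ σ 4 0 = m ∧
    σ 5 0 = F.guardIdx m ∧ (∀ k < m, σ 1 (F.guardIdx k) = rulerColor k) ∧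
    ∀ i, (∀ k < m, i ≠ F.guardIdx k) → σ 1 i = 0

lemma exec_search {σ : Mem} (h0 : σ 0 0 = F.n) (h1 : σ 0 1 = F.apex) {m : ℕ}
    (hm : m < F.twoChains.count) (hc : σ 5 0 = F.guardIdx m) :
    ∃ t, Exec F.inputPoints (.ite (.nlt curE apexE) searchRight searchLeft) σ
      (σ.store 6 0 (F.guardIdx (m + 1))) t ∧ t ≤ 100 * (F.n + 1) + 10 := by
  have hcost : (BExp.nlt curE apexE).cost = 5 := rfl
  have hh : (BExp.nlt curE apexE).Holds F.inputPoints σ ↔ F.guardIdx m < F.apex := by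
    simp [BExp.Holds, NExp.eval, curE, apexE, h1, hc]
  rcases guardIdx_cases hm with ⟨a1, a2, a3⟩ | ⟨a1, a2, a3⟩
  · obtain ⟨t, h2, h3⟩ := exec_searchRight h0 h1 a3 (hc.trans a2)
    have e : F.guardIdx (m + 1) = F.idx false (F.twoChains.hit true (F.twoChains.guard m)) := by
      rw [guardIdx, TwoChains.guard, side, a1]; rfl
    rw [e]
    exact ⟨_, .iteTrue (hh.2 (by omega)) h2, by omega⟩
  · obtain ⟨t, h2, h3⟩ := exec_searchLeft h1 a3 (hc.trans a2)
    have e : F.guardIdx (m + 1) = F.idx true (F.twoChains.hit false (F.twoChains.guard m)) := by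
      rw [guardIdx, TwoChains.guard, side, a1]; rfl
    rw [e]
    exact ⟨_, .iteFalse (by rw [hh]; omega) h2, by omega⟩

lemma exec_guardBody {σ : Mem} {m : ℕ} (hm : m < F.twoChains.count) (h : F.Placed m σ) :
    ∃ τ t, Exec F.inputPoints guardBody σ τ t ∧ t ≤ 100 * (F.n + 1) + 40 ∧ F.Placed (m + 1) τ := by
  obtain ⟨h0, h1, h2, h4, h5, h6, h7⟩ := h
  have hcol : σ 2 m = rulerColor m := by
    refine h2 m ?_
    -- The color table has `4 * F.n` entries, more than there are greedy guards.
    have e1 : F.twoChains.count ≤ 2 * F.apex := TwoChains.count_le (T := F.twoChains)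
    have e2 := F.apex_lt
    omega
  obtain ⟨t, e1, e2⟩ := exec_search
    (σ := (σ.store 1 (F.guardIdx m) (rulerColor m)).store 4 0 (m + 1))
    (by simpa [Mem.store] using h0) (by simpa [Mem.store] using h1) hm
    (by simpa [Mem.store] using h5)
  have s1 := Exec.set (pt := F.inputPoints) 1 curE (.get 2 countE) σ
  simp only [NExp.eval, curE, countE, h4, h5, hcol] at s1
  have s2 := Exec.set (pt := F.inputPoints) 4 (.lit 0) (.add countE (.lit 1))
    (σ.store 1 (F.guardIdx m) (rulerColor m))
  simp only [NExp.eval, countE, Mem.store_array_ne _ _ _ (show 4 ≠ 1 by omega), h4] at s2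
  refine ⟨_, _, .seq s1 (.seq s2 (.seq e1 (.set _ _ _ _))), ?_, ?_⟩
  · simp only [NExp.cost, nextE]
    omega
  · refine ⟨?_, ?_, ?_, ?_, ?_, ?_, ?_⟩
    · simpa [Mem.store] using h0
    · simpa [Mem.store] using h1
    · simpa [Mem.store] using h2
    · simp [Mem.store]
    · simp [Mem.store, NExp.eval, nextE]
    · intro k hk
      simp only [Mem.store, Function.update_apply, Nat.reduceEqDiff, if_true, if_false,
        OfNat.one_ne_ofNat]
      rcases Nat.lt_or_ge k m with hkm | hkm
      · rw [if_neg fun he => by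
          have := guardIdx_injective (F := F) (by omega) hm he
          omega, h6 k hkm]
      · rw [show k = m by omega, if_pos rfl]
    · intro i hi
      simp only [Mem.store, Function.update_apply, Nat.reduceEqDiff, if_true, if_false,
        OfNat.one_ne_ofNat]
      rw [if_neg (hi m (by omega)), h7 i fun k hk => hi k (by omega)]

/-- The algorithm places the greedy guards, in polynomial time. -/
lemma exec_greedy (F : Funnel) : ∃ τ t, Exec F.inputPoints greedy F.inputMem τ t ∧
    t ≤ 1000 * (F.n + 1) ^ 2 ∧
    (∀ k < F.twoChains.count, τ 1 (F.guardIdx k) = rulerColor k) ∧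
    ∀ i, (∀ k < F.twoChains.count, i ≠ F.guardIdx k) → τ 1 i = 0 := by
  have hn : F.inputMem 0 0 = F.n := rfl
  obtain ⟨σ, t, e1, e2, e3, e4⟩ := exec_fill (pt := F.inputPoints) (σ := F.inputMem) rfl
  rw [hn] at e2 e3
  obtain ⟨τ, u, g1, g2, g3⟩ := exec_while (pt := F.inputPoints) (b := guardTest) (P := guardBody)
    (c := 100 * (F.n + 1) + 40) F.twoChains.count (I := F.Placed)
    (by
      intro m hm τ h
      refine ⟨?_, exec_guardBody hm h⟩
      have h1 := h.2.1
      have h5 := h.2.2.2.2.1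
      have := guardIdx_ne_apex hm
      simp only [guardTest, BExp.Holds, NExp.eval, curE, apexE, h1, h5]
      omega)
    (by
      intro τ h
      have h1 := h.2.1
      have h5 := h.2.2.2.2.1
      rw [guardIdx_count] at h5
      simp [guardTest, BExp.Holds, NExp.eval, curE, apexE, h1, h5])
    (σ := σ) (by
      refine ⟨?_, ?_, e3, ?_, ?_, by simp, ?_⟩
      · rw [e4 0 (by omega) (by omega)]; rfl
      · rw [e4 0 (by omega) (by omega)]; rfl
      · rw [e4 4 (by omega) (by omega)]; rfl
      · rw [e4 5 (by omega) (by omega)]; rfl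
      · intro i _
        rw [e4 1 (by omega) (by omega)]; rfl)
  refine ⟨τ, _, .seq e1 g1, ?_, g3.2.2.2.2.2.1, g3.2.2.2.2.2.2⟩
  have hcost : guardTest.cost = 14 := rfl
  have hcount : F.twoChains.count ≤ 2 * F.apex := TwoChains.count_le (T := F.twoChains)
  have ha := F.apex_lt
  rw [hcost] at g2
  have : F.twoChains.count * (14 + (100 * (F.n + 1) + 40) + 1) ≤
      2 * F.n * (14 + (100 * (F.n + 1) + 40) + 1) := Nat.mul_le_mul_right _ (by omega)
  nlinarith

end Funnel

/-! ### The main theorem -/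

namespace Funnel

variable {F : Funnel}

lemma sees_vertex_iff {p : ℝ × ℝ} (hp : p ∈ F.region) {s : Bool} {j : ℕ} (hj : F.idx s j < F.n) :
    F.Sees p (F.v (F.idx s j)) ↔ F.twoChains.Sees (F.toNormal p) (F.twoChains.vertex s j) := by
  rw [sees_iff hp (vertex_mem_region hj), vertex_twoChains]
  rfl

/-- The number of greedy guards is bounded in terms of the number of colors of any conflict-free
guarding. -/
lemma count_le_of_isConflictFree {G : Finset (Fin F.n)} {c : Fin F.n → ℕ}
    (h : F.IsConflictFree G c) : F.twoChains.count + 4 ≤ 8 * 2 ^ numColors G c := by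
  let w : Fin F.n → Bool × ℕ := fun g =>
    if (g : ℕ) ≤ F.apex then (true, (g : ℕ)) else (false, F.n - 1 - g)
  have hn := F.apex_lt
  have hw : ∀ g : Fin F.n, F.idx (w g).1 (w g).2 = g := by
    intro g
    have := g.2
    by_cases hg : (g : ℕ) ≤ F.apex
    · simp [w, hg, idx]
    · simp only [w, hg, idx, if_false, Bool.false_eq_true]
      omega
  have hs : ∀ p ∈ F.region, ∀ g : Fin F.n, F.Sees p (F.v g) ↔
      F.twoChains.Sees (F.toNormal p) (F.twoChains.vertex (w g).1 (w g).2) := by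
    intro p hp g
    rw [← sees_vertex_iff hp (by rw [hw]; exact g.2), hw]
  refine TwoChains.count_le_of_conflictFree (T := F.twoChains) (G := G) (w := w) ?_ fun z hz => ?_
  · intro g _
    by_cases hg : (g : ℕ) ≤ F.apex
    · simp only [w, hg, if_true]
      exact hg
    · simp only [w, hg, if_false]
      show F.n - 1 - g ≤ F.n - 1 - F.apex
      omega
  · have hp : F.ofNormal z ∈ F.region := by rwa [mem_region_iff, toNormal_ofNormal]
    obtain ⟨g, hg, h1, h2⟩ := h _ hp
    refine ⟨g, hg, ?_, fun g' hg' h3 h4 => h2 g' hg' ?_ h4⟩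
    · rwa [hs _ hp, toNormal_ofNormal] at h1
    · rwa [hs _ hp, toNormal_ofNormal]

lemma exists_unique_guardIdx {p : ℝ × ℝ} (hp : p ∈ F.region) :
    ∃ k < F.twoChains.count, F.Sees p (F.v (F.guardIdx k)) ∧
      ∀ k' < F.twoChains.count, F.Sees p (F.v (F.guardIdx k')) →
        rulerColor k' = rulerColor k → k' = k := by
  obtain ⟨k, hk, h1, h2⟩ := TwoChains.exists_unique_guard (mem_region_iff.1 hp)
  exact ⟨k, hk, (sees_vertex_iff hp (guardIdx_lt hk)).2 h1, fun k' hk' h3 =>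
    h2 k' hk' ((sees_vertex_iff hp (guardIdx_lt hk')).1 h3)⟩

lemma guardNumber_le : F.guardNumber ≤ F.twoChains.count := by
  let S : Finset (Fin F.n) := Finset.univ.image fun k : Fin F.twoChains.count =>
    ⟨F.guardIdx k, guardIdx_lt k.2⟩
  have hS : F.IsGuarding S := by
    intro p hp
    obtain ⟨k, hk, h1, -⟩ := exists_unique_guardIdx hp
    exact ⟨⟨F.guardIdx k, guardIdx_lt hk⟩, Finset.mem_image.2 ⟨⟨k, hk⟩, Finset.mem_univ _, rfl⟩, h1⟩
  have hcard : S.card ≤ F.twoChains.count := by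
    simpa using Finset.card_image_le (s := Finset.univ)
      (f := fun k : Fin F.twoChains.count => (⟨F.guardIdx k, guardIdx_lt k.2⟩ : Fin F.n))
  have hmem : S.card ∈ {k | ∃ S : Finset (Fin F.n), F.IsGuarding S ∧ S.card = k} := ⟨S, hS, rfl⟩
  exact (Nat.sInf_le hmem).trans hcard

lemma mem_outputGuards_iff {τ : RAM.Mem}
    (h1 : ∀ k < F.twoChains.count, τ 1 (F.guardIdx k) = rulerColor k)
    (h2 : ∀ i, (∀ k < F.twoChains.count, i ≠ F.guardIdx k) → τ 1 i = 0)
    (g : Fin F.n) :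
    g ∈ F.outputGuards τ ↔ ∃ k < F.twoChains.count, (g : ℕ) = F.guardIdx k := by
  rw [outputGuards, Finset.mem_filter, outputColor]
  constructor
  · rintro ⟨-, h⟩
    by_contra! hc
    exact h (h2 g hc)
  · rintro ⟨k, hk, he⟩
    refine ⟨Finset.mem_univ _, ?_⟩
    rw [he, h1 k hk]
    exact (rulerColor_pos k).ne'

lemma isConflictFree_output {τ : RAM.Mem}
    (h1 : ∀ k < F.twoChains.count, τ 1 (F.guardIdx k) = rulerColor k)
    (h2 : ∀ i, (∀ k < F.twoChains.count, i ≠ F.guardIdx k) → τ 1 i = 0) :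
    F.IsConflictFree (F.outputGuards τ) (F.outputColor τ) := by
  intro p hp
  obtain ⟨k, hk, h3, h4⟩ := exists_unique_guardIdx hp
  refine ⟨⟨F.guardIdx k, guardIdx_lt hk⟩, (mem_outputGuards_iff h1 h2 _).2 ⟨k, hk, rfl⟩, h3, ?_⟩
  intro g' hg' hs hc
  obtain ⟨k', hk', he⟩ := (mem_outputGuards_iff h1 h2 _).1 hg'
  rw [he] at hs
  simp only [outputColor] at hc
  rw [he, h1 k hk, h1 k' hk'] at hc
  rw [h4 k' hk' hs hc] at he
  exact Fin.ext he

lemma numColors_output_le {τ : RAM.Mem}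
    (h1 : ∀ k < F.twoChains.count, τ 1 (F.guardIdx k) = rulerColor k)
    (h2 : ∀ i, (∀ k < F.twoChains.count, i ≠ F.guardIdx k) → τ 1 i = 0) :
    numColors (F.outputGuards τ) (F.outputColor τ) ≤ Nat.log 2 F.twoChains.count + 2 := by
  have hsub : (F.outputGuards τ).image (F.outputColor τ) ⊆
      Finset.Icc 1 (Nat.log 2 F.twoChains.count + 2) := by
    intro x hx
    obtain ⟨g, hg, rfl⟩ := Finset.mem_image.1 hx
    obtain ⟨k, hk, he⟩ := (mem_outputGuards_iff h1 h2 _).1 hg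
    rw [outputColor, he, h1 k hk, Finset.mem_Icc]
    exact ⟨rulerColor_pos k, (rulerColor_le k).trans
      (Nat.add_le_add_right (Nat.log_mono_right hk) 2)⟩
  simpa [numColors] using Finset.card_le_card hsub

end Funnel

theorem mainTheorem2 :
    -- the lower bound on the number of colors
    (∀ (F : Funnel) (G : Finset (Fin F.n)) (c : Fin F.n → ℕ), F.IsConflictFree G c →
      ⌊Real.logb 2 ((F.guardNumber : ℝ) + 3)⌋ - 3 ≤ (numColors G c : ℤ)) ∧
    -- the polynomial-time approximation within an additive error of four
    (∃ (A : RAM.Prog) (p : Polynomial ℕ), ∀ F : Funnel, ∃ (τ : RAM.Mem) (t : ℕ),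
      RAM.Exec F.inputPoints A F.inputMem τ t ∧ t ≤ p.eval F.n ∧
      F.IsConflictFree (F.outputGuards τ) (F.outputColor τ) ∧
      ∀ (G : Finset (Fin F.n)) (c : Fin F.n → ℕ), F.IsConflictFree G c →
        numColors (F.outputGuards τ) (F.outputColor τ) ≤ numColors G c + 4) := by
  refine ⟨fun F G c h => ?_, RAM.greedy, 1000 * (Polynomial.X + 1) ^ 2, fun F => ?_⟩
  · have h1 := Funnel.count_le_of_isConflictFree h
    have h2 := F.guardNumber_le
    -- From `guardNumber ≤ count` and `count + 4 ≤ 8 * 2 ^ numColors G c`.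
    have h3 : F.guardNumber + 3 < 2 ^ (numColors G c + 3) := by
      rw [pow_add]; omega
    have h4 : Real.logb 2 ((F.guardNumber : ℝ) + 3) < (numColors G c + 3 : ℕ) := by
      rw [Real.logb_lt_iff_lt_rpow (by norm_num) (by positivity), Real.rpow_natCast]
      exact_mod_cast h3
    have h5 : ⌊Real.logb 2 ((F.guardNumber : ℝ) + 3)⌋ < ((numColors G c + 3 : ℕ) : ℤ) := by
      rw [Int.floor_lt]
      exact_mod_cast h4
    push_cast at h5
    omega
  · obtain ⟨τ, t, h1, h2, h3, h4⟩ := F.exec_greedy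
    refine ⟨τ, t, h1, by simpa using h2, Funnel.isConflictFree_output h3 h4, fun G c h => ?_⟩
    have h5 := Funnel.count_le_of_isConflictFree h
    have h6 := Funnel.numColors_output_le h3 h4
    -- The logarithm is at most `numColors G c + 2`; the two extra colors of the ruler coloring make
    -- the error four.
    have h7 : Nat.log 2 F.twoChains.count < numColors G c + 3 := by
      refine Nat.log_lt_of_lt_pow TwoChains.count_pos.ne' ?_
      rw [pow_add]; omega
    omega
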